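/- Let $n\ge 1$. For a finite field $\mathbb F_q$ of odd characteristic and $d\ge 0$, let $\mathscr X$ be the set of flags $0=V_0\subseteq V_1\subseteq\dots\subseteq V_n=\mathbb F_q^d$. The $GL_d(\mathbb F_q)$-orbits $\mathcal O_A$ on $\mathscr X\times\mathscr X$ are labelled by the set $\Theta_d$ of $n\times n$ matrices $A$ over $\mathbb N$ with sum of entries $d$; the orbit of $(V,V')$ has matrix entries $a_{ij}=\dim\frac{V_{i-1}+V_i\cap V'_j}{V_{i-1}+V_i\cap V'_{j-1}}$. Let $\mathcal S_d$ be the generic Schur algebra over $\mathbb Q(v)$: it has basis $e_A$ $(A\in\Theta_d)$ and product $e_A*e_B=\sum_C g_{A,B}^C(v^2)\,e_C$, where $g_{A,B}^C\in\mathbb Z[x]$ is the polynomial such that, for every such $q$ and every $(V,V')\in\mathcal O_C$, $g_{A,B}^C(q)=\#\{V''\in\mathscr X : (V,V'')\in\mathcal O_A,\ (V'',V')\in\mathcal O_B\}$. Put $[A]=v^{-(d(A)-r(A))}e_A$ with $d(A)=\dim\mathcal O_A=\sum_{i<k\text{ or }j<l}a_{ij}a_{kl}$ and $r(A)=d(B)$,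 where $B$ is the diagonal matrix with $b_{ii}=\sum_k a_{ik}$. Let $\widetilde\Theta$ be the set of integer $n\times n$ matrices with nonnegative off-diagonal entries, and let $\mathrm{ro}(A),\mathrm{co}(A)\in\mathbb Z^n$ be the vectors of row and column sums of $A\in\widetilde\Theta$. For $A,B\in\widetilde\Theta$ with $\mathrm{co}(A)=\mathrm{ro}(B)$ set $[A]\cdot[B]=\sum_Z G_Z(v,1)[Z]$, where $(G_Z)_{Z\in\widetilde\Theta}$ is the finitely supported family in $\mathbb Q(v)[v']$ with $[A+pI]*[B+pI]=\sum_Z G_Z(v,v^{-p})[Z+pI]$ in $\mathcal S_d$, $d$ being the sum of the entries of $A+pI$, for all large $p$; set $[A]\cdot[B]=0$ if $\mathrm{co}(A)\ne\mathrm{ro}(B)$. Let $\hat{\mathcal K}$ be the $\mathbb Q(v)$-space of formal sums $\sum_{A\in\widetilde\Theta}\xi_A[A]$, $\xi_A\in\mathbb Q(v)$, such that for every $\mathbf t\in\mathbb Z^n$ only finitely many $A$ with $\mathrm{ro}(A)=\mathbf t$, and only finitely many $A$ with $\mathrm{co}(A)=\mathbf t$, have $\xi_A\neq0$; its product is $\sum_A\xi_A[A]\cdot\sum_B\eta_B[B]=\sum_{A,B}\xi_A\eta_B\,[A]\cdot[B]$.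 For $\hat A\in\widetilde\Theta$ with zero diagonal and $\mathbf j\in\mathbb Z^n$ put $\hat A(\mathbf j)=\sum_{\lambda\in\mathbb Z^n}v^{\lambda_1j_1+\dots+\lambda_nj_n}[\hat A+\mathrm{diag}(\lambda)]\in\hat{\mathcal K}$. Let $\underline i$ be the $i$-th unit vector and $E_{ij}$ the matrix units, and define $$\overline t_{ij}=-(v^{-1}-v)\,E_{ij}(\underline i)\ (i<j),\qquad \overline t_{ii}=0(\underline i),\qquad \overline t_{ij}=0\ (i>j).$$ Let $\mathcal U\subset\hat{\mathcal K}$ be the subalgebra generated by all $\overline t_{ij}$, $1\le i,j\le n$. Then for all $i,j,a,b\in\{1,\dots,n\}$ the products of basis elements that enter $\overline t_{ia}\overline t_{jb}$ are well defined (for all large $p$ the polynomials $g$ that enter $[A+pI]*[B+pI]$, and the family $(G_Z)$, exist and are unique), and in $\mathcal U$ $$v^{-\delta_{ij}}\,\overline t_{ia}\overline t_{jb}-v^{-\delta_{ab}}\,\overline t_{jb}\overline t_{ia}=(v^{-1}-v)(\delta_{b<a}-\delta_{i<j})\,\overline t_{ja}\overline t_{ib},$$ where $\delta_P$ is $1$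 if $P$ holds and $0$ otherwise. -/

import Mathlib

open scoped Polynomial

noncomputable section

namespace BLM

/-! ### Partial flags over finite fields and their relative position -/

/-- `n`-step flags `0 = V₀ ⊆ V₁ ⊆ ⋯ ⊆ Vₙ = F ^ d`. -/
structure Flag (F : Type) [Field F] (n d : ℕ) where
  space : Fin (n + 1) → Submodule F (Fin d → F)
  le_succ : ∀ i : Fin n, space i.castSucc ≤ space i.succ
  space_zero : space 0 = ⊥
  space_last : space (Fin.last n) = ⊤

/-- The matrix of the pair `(V, W)`: its `(i, j)` entry is
`dim (Vᵢ₋₁ + Vᵢ ∩ Wⱼ) / (Vᵢ₋₁ + Vᵢ ∩ Wⱼ₋₁)`. With indices in `Fin n`, the step number `i` of the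
flag goes from `V.space i.castSucc` to `V.space i.succ`. -/
def relPos {F : Type} [Field F] {n d : ℕ} (V W : Flag F n d) : Matrix (Fin n) (Fin n) ℕ :=
  Matrix.of fun i j =>
    Module.finrank F
      (↥(V.space i.castSucc ⊔ V.space i.succ ⊓ W.space j.succ) ⧸
        (V.space i.castSucc ⊔ V.space i.succ ⊓ W.space j.castSucc).submoduleOf
          (V.space i.castSucc ⊔ V.space i.succ ⊓ W.space j.succ))

/-- `Θ_d`: the `n × n` matrices over `ℕ` with sum of entries `d`. They label the orbits of
`GL_d(F)` on pairs of flags. -/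
abbrev Theta (n d : ℕ) : Type := {M : Matrix (Fin n) (Fin n) ℕ // ∑ i, ∑ j, M i j = d}

theorem theta_entry_le {n d : ℕ} (M : Theta n d) (i j : Fin n) : M.1 i j ≤ d := by
  refine le_trans ?_ M.2.le
  exact (Finset.single_le_sum (f := fun j => M.1 i j) (fun _ _ => Nat.zero_le _)
    (Finset.mem_univ j)).trans
      (Finset.single_le_sum (f := fun i => ∑ j, M.1 i j) (fun _ _ => Nat.zero_le _)
        (Finset.mem_univ i))

instance instFiniteTheta (n d : ℕ) : Finite (Theta n d) :=
  Finite.of_injective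
    (fun (M : Theta n d) (i j : Fin n) =>
      (⟨M.1 i j, Nat.lt_succ_of_le (theta_entry_le M i j)⟩ : Fin (d + 1)))
    (fun _ _ h => Subtype.ext (Matrix.ext fun i j =>
      congrArg Fin.val (congrFun (congrFun h i) j)))

instance instFintypeTheta (n d : ℕ) : Fintype (Theta n d) := Fintype.ofFinite _

/-- `P` computes the coefficient of `e_C` in the convolution product `e_A * e_B` over all finite
fields of odd characteristic, as a polynomial in the number `q` of elements of the field. -/
def IsCountingPolynomial {n d : ℕ} (A B C : Theta n d) (P : ℤ[X]) : Prop :=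
  ∀ (F : Type) [Field F] [Fintype F], ringChar F ≠ 2 →
    ∀ V W : Flag F n d, relPos V W = C.1 →
      (Nat.card {U : Flag F n d // relPos V U = A.1 ∧ relPos U W = B.1} : ℤ) =
        P.eval (Fintype.card F : ℤ)

open Classical in
/-- The coefficient of `e_C` in `e_A * e_B`, as the polynomial in `q = v²` (it exists and is
unique; the value `0` in the other case is never used). -/
def countingPolynomial {n d : ℕ} (A B C : Theta n d) : ℤ[X] :=
  if h : ∃ P, IsCountingPolynomial A B C P then h.choose else 0

/-! ### The generic Schur algebra, with scalars extended to `ℚ(v)` -/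

/-- The field `ℚ(v)`. -/
abbrev Qv : Type := RatFunc ℚ

/-- The indeterminate `v`. -/
def v : Qv := RatFunc.X

/-- The Schur algebra `S_d` over `ℚ(v)`. An invariant function on pairs of flags is a function on
the set `Θ_d` of orbits. -/
abbrev Schur (n d : ℕ) : Type := Theta n d → Qv

/-- The convolution product of the generic Schur algebra, in which `q = v²`. -/
def schurMul {n d : ℕ} (f g : Schur n d) : Schur n d := fun C =>
  ∑ A, ∑ B, f A * g B * Polynomial.aeval (v ^ 2) (countingPolynomial A B C)

/-- `d(A) = dim O_A = ∑ a_{ij} a_{kl}` over `i < k` or `j < l`. -/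
def orbitDim {n : ℕ} (A : Matrix (Fin n) (Fin n) ℕ) : ℤ :=
  ∑ i, ∑ j, ∑ k, ∑ l, if i < k ∨ j < l then (A i j : ℤ) * (A k l : ℤ) else 0

/-- `r(A) = dim O_B`, where `B` is diagonal with entries the row sums of `A`. -/
def orbitRowDim {n : ℕ} (A : Matrix (Fin n) (Fin n) ℕ) : ℤ :=
  orbitDim (Matrix.diagonal fun i => ∑ j, A i j)

open Classical in
/-- The element `[M] = v ^ (-(d(M) - r(M))) e_M` of `S_d` for an integer matrix `M` in `Θ_d`
(and `0` for integer matrices not in `Θ_d`). -/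
def bracket {n : ℕ} (d : ℕ) (M : Matrix (Fin n) (Fin n) ℤ) : Schur n d := fun C =>
  if C.1.map (fun m : ℕ => (m : ℤ)) = M then v ^ (-(orbitDim C.1 - orbitRowDim C.1)) else 0

/-! ### Stabilization and the algebra `K` -/

/-- `Θ̃`: integer `n × n` matrices with nonnegative entries off the diagonal. -/
abbrev ThetaTilde (n : ℕ) : Type :=
  {M : Matrix (Fin n) (Fin n) ℤ // ∀ i j, i ≠ j → 0 ≤ M i j}

/-- Row sums. -/
def ro {n : ℕ} (A : ThetaTilde n) : Fin n → ℤ := fun i => ∑ j, A.1 i j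

/-- Column sums. -/
def co {n : ℕ} (A : ThetaTilde n) : Fin n → ℤ := fun j => ∑ i, A.1 i j

/-- The matrix `ₚA = A + p I`. -/
def shift {n : ℕ} (p : ℕ) (A : ThetaTilde n) : Matrix (Fin n) (Fin n) ℤ :=
  A.1 + (p : ℤ) • (1 : Matrix (Fin n) (Fin n) ℤ)

/-- The finite family `G = (G_Z)` of polynomials in `v'` over `ℚ(v)` satisfies
`[ₚA] * [ₚB] = ∑_Z G_Z(v, v⁻ᵖ) [ₚZ]` for all large `p`. (The matrices `Z` that occur in the product
have the row sums of `A` and the column sums of `B`.) -/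
def IsStabilization {n : ℕ} (A B : ThetaTilde n) (G : ThetaTilde n →₀ Qv[X]) : Prop :=
  (∀ Z ∈ G.support, ro Z = ro A ∧ co Z = co B) ∧
  ∃ p₀ : ℕ, ∀ p : ℕ, p₀ ≤ p → ∀ d : ℕ,
    schurMul (bracket d (shift p A)) (bracket d (shift p B)) =
      G.sum fun Z g => g.eval (v ^ (-(p : ℤ))) • bracket d (shift p Z)

/-- The stabilized product of `[A]` and `[B]` is well defined: for large `p` the structure
constants of the Schur algebra that enter `[ₚA] * [ₚB]` exist and are unique, and so does the
family `G` with `[ₚA] * [ₚB] = ∑_Z G_Z(v, v⁻ᵖ) [ₚZ]`. -/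
def StableProductDefined {n : ℕ} (A B : ThetaTilde n) : Prop :=
  (∃ p₀ : ℕ, ∀ p : ℕ, p₀ ≤ p → ∀ (d : ℕ) (A' B' C : Theta n d),
    A'.1.map (fun m : ℕ => (m : ℤ)) = shift p A → B'.1.map (fun m : ℕ => (m : ℤ)) = shift p B →
      ∃! P : ℤ[X], IsCountingPolynomial A' B' C P) ∧
  ∃! G : ThetaTilde n →₀ Qv[X], IsStabilization A B G

open Classical in
/-- The product `[A] · [B] = ∑_Z G_Z(v, 1) [Z]` in `K`, extended to `ℚ(v)`; it is `0` if
`co A ≠ ro B`. -/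
def kMul {n : ℕ} (A B : ThetaTilde n) : ThetaTilde n →₀ Qv :=
  if h : co A = ro B ∧ ∃ G, IsStabilization A B G then
    h.2.choose.mapRange (Polynomial.eval 1) Polynomial.eval_zero
  else 0

theorem kMul_ne_zero {n : ℕ} {A B C : ThetaTilde n} (h : kMul A B C ≠ 0) :
    co A = ro B ∧ ro C = ro A ∧ co C = co B := by
  unfold kMul at h
  split_ifs at h with hAB
  · refine ⟨hAB.1, hAB.2.choose_spec.1 C ?_⟩
    rw [Finsupp.mem_support_iff]
    intro h0
    exact h (by rw [Finsupp.mapRange_apply, h0, Polynomial.eval_zero])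
  · simp at h

/-! ### The completed algebra `K̂` -/

/-- `K̂`: formal sums `∑ ξ_A [A]` over `Θ̃` with finitely many nonzero terms of each given vector of
row sums and of each given vector of column sums. -/
def Khat (n : ℕ) : Submodule Qv (ThetaTilde n → Qv) where
  carrier := {ξ | ∀ t : Fin n → ℤ,
    {A | ro A = t ∧ ξ A ≠ 0}.Finite ∧ {A | co A = t ∧ ξ A ≠ 0}.Finite}
  zero_mem' := fun t => by simp
  add_mem' := fun {ξ η} hξ hη t => by
    constructor
    · refine ((hξ t).1.union (hη t).1).subset ?_
      rintro A ⟨hA, h⟩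
      by_cases h1 : ξ A = 0
      · exact Or.inr ⟨hA, fun h2 => h (by simp [h1, h2])⟩
      · exact Or.inl ⟨hA, h1⟩
    · refine ((hξ t).2.union (hη t).2).subset ?_
      rintro A ⟨hA, h⟩
      by_cases h1 : ξ A = 0
      · exact Or.inr ⟨hA, fun h2 => h (by simp [h1, h2])⟩
      · exact Or.inl ⟨hA, h1⟩
  smul_mem' := fun c ξ hξ t => by
    constructor
    · refine (hξ t).1.subset ?_
      rintro A ⟨hA, h⟩
      exact ⟨hA, fun h2 => h (by simp [h2])⟩
    · refine (hξ t).2.subset ?_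
      rintro A ⟨hA, h⟩
      exact ⟨hA, fun h2 => h (by simp [h2])⟩

/-- The coefficients of `(∑ ξ_A [A]) · (∑ η_B [B]) = ∑ ξ_A η_B [A] · [B]`. -/
def mulCoeff {n : ℕ} (ξ η : ThetaTilde n → Qv) : ThetaTilde n → Qv := fun C =>
  ∑ᶠ p : ThetaTilde n × ThetaTilde n, ξ p.1 * η p.2 * kMul p.1 p.2 C

theorem mulCoeff_support_finite {n : ℕ} (ξ η : Khat n) (C : ThetaTilde n) :
    (Function.support fun p : ThetaTilde n × ThetaTilde n =>
      ξ.1 p.1 * η.1 p.2 * kMul p.1 p.2 C).Finite := by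
  refine ((ξ.2 (ro C)).1.prod (η.2 (co C)).2).subset ?_
  rintro ⟨A, B⟩ h
  obtain ⟨h1, h2⟩ := mul_ne_zero_iff.1 h
  obtain ⟨h3, h4⟩ := mul_ne_zero_iff.1 h1
  obtain ⟨-, h5, h6⟩ := kMul_ne_zero h2
  exact ⟨⟨h5.symm, h3⟩, ⟨h6.symm, h4⟩⟩

theorem exists_of_mulCoeff_ne_zero {n : ℕ} {ξ η : ThetaTilde n → Qv} {C : ThetaTilde n}
    (h : mulCoeff ξ η C ≠ 0) : ∃ A B, ξ A ≠ 0 ∧ η B ≠ 0 ∧ kMul A B C ≠ 0 := by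
  have hex : ∃ p : ThetaTilde n × ThetaTilde n, ξ p.1 * η p.2 * kMul p.1 p.2 C ≠ 0 := by
    by_contra hne
    push Not at hne
    exact h (finsum_eq_zero_of_forall_eq_zero hne)
  obtain ⟨⟨A, B⟩, hp⟩ := hex
  obtain ⟨h1, h2⟩ := mul_ne_zero_iff.1 hp
  obtain ⟨h3, h4⟩ := mul_ne_zero_iff.1 h1
  exact ⟨A, B, h3, h4, h2⟩

theorem mulCoeff_mem {n : ℕ} (ξ η : Khat n) : mulCoeff ξ.1 η.1 ∈ Khat n := by
  intro t
  constructor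
  · refine ((ξ.2 t).1.biUnion fun A _ => (η.2 (co A)).1.biUnion fun B _ =>
      (kMul A B).support.finite_toSet).subset ?_
    rintro C ⟨hC, h⟩
    obtain ⟨A, B, h1, h2, h3⟩ := exists_of_mulCoeff_ne_zero h
    obtain ⟨h4, h5, h6⟩ := kMul_ne_zero h3
    refine Set.mem_biUnion (x := A) ⟨h5 ▸ hC, h1⟩ (Set.mem_biUnion (x := B) ⟨h4.symm, h2⟩ ?_)
    simpa using h3
  · refine ((η.2 t).2.biUnion fun B _ => (ξ.2 (ro B)).2.biUnion fun A _ =>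
      (kMul A B).support.finite_toSet).subset ?_
    rintro C ⟨hC, h⟩
    obtain ⟨A, B, h1, h2, h3⟩ := exists_of_mulCoeff_ne_zero h
    obtain ⟨h4, h5, h6⟩ := kMul_ne_zero h3
    refine Set.mem_biUnion (x := B) ⟨h6 ▸ hC, h2⟩ (Set.mem_biUnion (x := A) ⟨h4, h1⟩ ?_)
    simpa using h3

instance instMulKhat (n : ℕ) : Mul (Khat n) := ⟨fun ξ η => ⟨mulCoeff ξ.1 η.1, mulCoeff_mem ξ η⟩⟩

theorem Khat_mul_apply {n : ℕ} (ξ η : Khat n) (C : ThetaTilde n) :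
    (ξ * η).1 C = ∑ᶠ p : ThetaTilde n × ThetaTilde n, ξ.1 p.1 * η.1 p.2 * kMul p.1 p.2 C := rfl

instance instRingKhat (n : ℕ) : NonUnitalNonAssocRing (Khat n) :=
  { (inferInstance : AddCommGroup (Khat n)), instMulKhat n with
    left_distrib := fun ξ η ζ => by
      refine Subtype.ext (funext fun C => ?_)
      change (ξ * (η + ζ)).1 C = (ξ * η).1 C + (ξ * ζ).1 C
      simp only [Khat_mul_apply]
      rw [← finsum_add_distrib (mulCoeff_support_finite ξ η C) (mulCoeff_support_finite ξ ζ C)]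
      refine finsum_congr fun p => ?_
      change ξ.1 p.1 * (η.1 p.2 + ζ.1 p.2) * _ = _
      ring
    right_distrib := fun ξ η ζ => by
      refine Subtype.ext (funext fun C => ?_)
      change ((ξ + η) * ζ).1 C = (ξ * ζ).1 C + (η * ζ).1 C
      simp only [Khat_mul_apply]
      rw [← finsum_add_distrib (mulCoeff_support_finite ξ ζ C) (mulCoeff_support_finite η ζ C)]
      refine finsum_congr fun p => ?_
      change (ξ.1 p.1 + η.1 p.1) * ζ.1 p.2 * _ = _
      ring
    zero_mul := fun ξ => by
      refine Subtype.ext (funext fun C => ?_)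
      change ((0 : Khat n) * ξ).1 C = 0
      rw [Khat_mul_apply]
      refine finsum_eq_zero_of_forall_eq_zero fun p => ?_
      change (0 : Qv) * ξ.1 p.2 * _ = 0
      ring
    mul_zero := fun ξ => by
      refine Subtype.ext (funext fun C => ?_)
      change (ξ * (0 : Khat n)).1 C = 0
      rw [Khat_mul_apply]
      refine finsum_eq_zero_of_forall_eq_zero fun p => ?_
      change ξ.1 p.1 * (0 : Qv) * _ = 0
      ring }

instance instScalarTowerKhat (n : ℕ) : IsScalarTower Qv (Khat n) (Khat n) :=
  ⟨fun c ξ η => by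
    refine Subtype.ext (funext fun C => ?_)
    change ((c • ξ) * η).1 C = c * (ξ * η).1 C
    rw [Khat_mul_apply, Khat_mul_apply, mul_finsum]
    refine finsum_congr fun p => ?_
    change c * ξ.1 p.1 * η.1 p.2 * _ = _
    ring⟩

instance instSMulCommKhat (n : ℕ) : SMulCommClass Qv (Khat n) (Khat n) :=
  ⟨fun c ξ η => by
    refine Subtype.ext (funext fun C => ?_)
    change c * (ξ * η).1 C = (ξ * (c • η)).1 C
    rw [Khat_mul_apply, Khat_mul_apply, mul_finsum]
    refine finsum_congr fun p => ?_
    change _ = ξ.1 p.1 * (c * η.1 p.2) * _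
    ring⟩

/-! ### The elements `Â(j)` and the generators of `U` -/

/-- `Θ⁰`: the matrices in `Θ̃` with zero diagonal. -/
abbrev ThetaZero (n : ℕ) : Type := {A : ThetaTilde n // ∀ i, A.1 i i = 0}

/-- `Â + D_λ`. -/
def addDiag {n : ℕ} (A : ThetaZero n) (lam : Fin n → ℤ) : ThetaTilde n :=
  ⟨A.1.1 + Matrix.diagonal lam, fun i j hij => by
    simpa [Matrix.diagonal_apply_ne _ hij] using A.1.2 i j hij⟩

theorem ro_addDiag {n : ℕ} (A : ThetaZero n) (lam : Fin n → ℤ) (i : Fin n) :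
    ro (addDiag A lam) i = ro A.1 i + lam i := by
  simp [ro, addDiag, Finset.sum_add_distrib, Matrix.diagonal_apply]

theorem co_addDiag {n : ℕ} (A : ThetaZero n) (lam : Fin n → ℤ) (i : Fin n) :
    co (addDiag A lam) i = co A.1 i + lam i := by
  simp [co, addDiag, Finset.sum_add_distrib, Matrix.diagonal_apply]

open Classical in
/-- `Â(j) = ∑_λ v ^ (λ₁ j₁ + ⋯ + λₙ jₙ) [Â + D_λ]`, the sum over all `λ ∈ ℤⁿ`. The coefficient of
`[M]` is nonzero only if `M = Â + D_λ`, and then `λ` is the diagonal of `M`. -/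
def hatElt {n : ℕ} (A : ThetaZero n) (j : Fin n → ℤ) : Khat n :=
  ⟨fun M => if ∃ lam, M = addDiag A lam then v ^ (∑ k, M.1 k k * j k) else 0, fun t => by
    constructor
    · refine (Set.finite_singleton (addDiag A fun i => t i - ro A.1 i)).subset ?_
      rintro M ⟨hM, h⟩
      obtain ⟨lam, rfl⟩ := (ite_ne_right_iff.1 h).1
      refine congrArg (addDiag A) (funext fun i => ?_)
      have := congrFun hM i
      rw [ro_addDiag] at this
      omega
    · refine (Set.finite_singleton (addDiag A fun i => t i - co A.1 i)).subset ?_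
      rintro M ⟨hM, h⟩
      obtain ⟨lam, rfl⟩ := (ite_ne_right_iff.1 h).1
      refine congrArg (addDiag A) (funext fun i => ?_)
      have := congrFun hM i
      rw [co_addDiag] at this
      omega⟩

/-- The zero matrix, as an element of `Θ⁰`. -/
def zeroMat (n : ℕ) : ThetaZero n := ⟨⟨0, fun _ _ _ => le_refl _⟩, fun _ => rfl⟩

/-- The matrix unit `E_{ij}`, `i < j`, as an element of `Θ⁰`. -/
def unitMat {n : ℕ} (i j : Fin n) (hij : i < j) : ThetaZero n :=
  ⟨⟨Matrix.single i j 1, fun k l _ => by rw [Matrix.single_apply]; split_ifs <;> simp⟩, fun k => by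
    change Matrix.single i j (1 : ℤ) k k = 0
    rw [Matrix.single_apply, if_neg]
    rintro ⟨rfl, rfl⟩
    exact lt_irrefl _ hij⟩

/-- The generators: `t̄_{ij} = -(v⁻¹ - v) E_{ij}(i)` for `i < j`, `t̄_{ii} = 0(i)`, and
`t̄_{ij} = 0` for `i > j`; the argument `(i)` is the `i`-th unit vector of `ℤⁿ`. -/
def tbar {n : ℕ} (i j : Fin n) : Khat n :=
  if hij : i < j then (-(v⁻¹ - v)) • hatElt (unitMat i j hij) (Pi.single i 1)
  else if i = j then hatElt (zeroMat n) (Pi.single i 1)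
  else 0

/-- The subalgebra `U` of `K̂` generated by the `t̄_{ij}` (with the unit `0(0) = ∑_λ [D_λ]`
of `K̂`). -/
def U (n : ℕ) : NonUnitalSubalgebra Qv (Khat n) :=
  NonUnitalAlgebra.adjoin Qv
    (insert (hatElt (zeroMat n) 0) (Set.range fun p : Fin n × Fin n => tbar p.1 p.2))

/-- The generators as elements of `U`. -/
def tU {n : ℕ} (i j : Fin n) : U n :=
  ⟨tbar i j, NonUnitalAlgebra.subset_adjoin Qv (Set.mem_insert_of_mem _ ⟨(i, j), rfl⟩)⟩

/-- The Kronecker symbol of a proposition: `1` if it holds and `0` otherwise. -/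
def delta (p : Prop) [Decidable p] : ℤ := if p then 1 else 0

end BLM

end

/-!
A matrix `E_{ia} + diag` with `i ≤ a` is the relative position of flags `U ⊆ V` for which
`V_r / U_r` is a line when `i ≤ r < a` and zero otherwise, the lines being carried isomorphically
onto each other. Hence the products that enter `t̄_{ia} t̄_{jb}` count flags `U` between `V` and `W`
such that `V / U` and `U / W` are the interval representations on `[i, a)` and `[j, b)`. Then
`V / W` is either the split extension, of relative position `E_{ia} + E_{jb} + diag`, or, when
`i < j ≤ a < b`, the nonsplit one, of relative position `E_{ib} + E_{ja} + diag`. If the two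
intervals meet, `U` is determined by a line in the plane `V_r / W_r` with `r = max i j`, subject to
containing or avoiding lines cut out by the other steps of `V` and `W`; so there are `q + 1`, `q`,
`q - 1` or `1` such flags.

The powers of `v` that normalize the basis elements contribute a factor unaffected by adding `p I`,
so the stabilizing family is constant in `v'`. Every product `t̄_{ia} t̄_{jb}` is thereby an
explicit combination of two families of basis elements, and the relation is a comparison of Laurent
polynomials in `v` for each relative order of `i`, `j` and of `a`, `b`.
-/

noncomputable section

namespace BLM

open Module

/-! ### Chains of subspaces -/

section Chains

variable {F E : Type*} [Field F] [AddCommGroup E] [Module F E]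

/-- The indicator of `k < r ∧ s ≤ l`. For `r ≤ s` it is the rank of the map from degree `r` to
degree `s` in the interval representation supported on `k < t ≤ l`. -/
def box (k l r s : ℕ) : ℕ := if k < r ∧ s ≤ l then 1 else 0

theorem box_of_pos {k l r s : ℕ} (h : k < r ∧ s ≤ l) : box k l r s = 1 := if_pos h

theorem box_of_neg {k l r s : ℕ} (h : ¬(k < r ∧ s ≤ l)) : box k l r s = 0 := if_neg h

/-- The chain `W` lies below `V`, and `δ r s` is the codimension of `V r ⊓ W s` in `V r`, which is
the rank of the map `V r / W r → V s / W s`. -/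
structure HasDefect (V W : ℕ → Submodule F E) (δ : ℕ → ℕ → ℕ) : Prop where
  le : ∀ s, W s ≤ V s
  finrank_inf : ∀ r s, r ≤ s → finrank F ↥(V r ⊓ W s) + δ r s = finrank F (V r)

/-- The quotient of the chain `V` by `U` is the interval representation supported on
`i < s ≤ a`. -/
structure IsStep (i a : ℕ) (V U : ℕ → Submodule F E) : Prop where
  le : ∀ s, U s ≤ V s
  ge : ∀ s, ¬(i < s ∧ s ≤ a) → V s ≤ U s
  rank : ∀ s, i < s → s ≤ a → finrank F (V s) = finrank F (U s) + 1
  not_le : i < a → ¬V (i + 1) ≤ U a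

/-- Away from the region `i < r ≤ j ≤ a < s ≤ b`, the ranks in the quotient of `V` by `W` are those
of the direct sum of the interval representations on `i < t ≤ a` and `j < t ≤ b`. A composite of
two steps satisfies this whether or not the extension splits. -/
structure QuasiSplit (i a j b : ℕ) (V W : ℕ → Submodule F E) : Prop where
  le : ∀ s, W s ≤ V s
  finrank_inf : ∀ r s, r ≤ s → ¬(i < r ∧ r ≤ j ∧ j ≤ a ∧ a < s ∧ s ≤ b) →
    finrank F ↥(V r ⊓ W s) + (box i a r s + box j b r s) = finrank F (V r)

variable {V U W : ℕ → Submodule F E} {i a j b r s : ℕ} {δ : ℕ → ℕ → ℕ}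

theorem HasDefect.finrank_eq (h : HasDefect V W δ) (s : ℕ) :
    finrank F (W s) + δ s s = finrank F (V s) := by
  rw [← h.finrank_inf s s le_rfl, inf_eq_right.2 (h.le s)]

theorem HasDefect.not_le (h : HasDefect V W δ) (hrs : r ≤ s) (hδ : 0 < δ r s) :
    ¬V r ≤ W s := fun hle => by
  have hrank := h.finrank_inf r s hrs
  rw [inf_eq_left.2 hle] at hrank
  omega

theorem QuasiSplit.finrank_eq (h : QuasiSplit i a j b V W) (s : ℕ) :
    finrank F (W s) + (box i a s s + box j b s s) = finrank F (V s) := by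
  rw [← h.finrank_inf s s le_rfl (by omega), inf_eq_right.2 (h.le s)]

theorem QuasiSplit.not_le (h : QuasiSplit i a j b V W) (hrs : r ≤ s)
    (hn : ¬(i < r ∧ r ≤ j ∧ j ≤ a ∧ a < s ∧ s ≤ b)) (hbox : 0 < box i a r s + box j b r s) :
    ¬V r ≤ W s := fun hle => by
  have hrank := h.finrank_inf r s hrs hn
  rw [inf_eq_left.2 hle] at hrank
  omega

theorem HasDefect.quasiSplit (h : HasDefect V W fun r s => box i a r s + box j b r s) :
    QuasiSplit i a j b V W :=
  ⟨h.le, fun r s hrs _ => h.finrank_inf r s hrs⟩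

theorem HasDefect.quasiSplit_of_crossing
    (h : HasDefect V W fun r s => box i b r s + box j a r s) (hc : i < j ∧ j ≤ a ∧ a < b) :
    QuasiSplit i a j b V W := by
  refine ⟨h.le, fun r s hrs hn => ?_⟩
  rw [← h.finrank_inf r s hrs]
  simp only [box]
  split_ifs <;> omega

theorem QuasiSplit.hasDefect_of_le (h : QuasiSplit i a j b V W) (hV : Monotone V)
    (hW : Monotone W) (hle : i < j ∧ j ≤ a ∧ a < b → V j ≤ W (a + 1)) :
    HasDefect V W fun r s => box i a r s + box j b r s := by
  refine ⟨h.le, fun r s hrs => ?_⟩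
  by_cases hn : i < r ∧ r ≤ j ∧ j ≤ a ∧ a < s ∧ s ≤ b
  · have hVW : V r ≤ W s := (hV hn.2.1).trans ((hle (by omega)).trans (hW (by omega)))
    rw [inf_eq_left.2 hVW, box_of_neg (by omega), box_of_neg (by omega)]
    rfl
  · exact h.finrank_inf r s hrs hn

theorem IsStep.eq (h : IsStep i a V U) (hs : ¬(i < s ∧ s ≤ a)) : V s = U s :=
  le_antisymm (h.ge s hs) (h.le s)

theorem IsStep.not_le_of_le (h : IsStep i a V U) (hV : Monotone V) (hU : Monotone U) (hr : i < r)
    (hrs : r ≤ s) (hs : s ≤ a) : ¬V r ≤ U s := fun hle =>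
  h.not_le (by omega) ((hV hr).trans (hle.trans (hU hs)))

theorem IsStep.le_of_not (h : IsStep i a V U) (hV : Monotone V) (hU : Monotone U) (hrs : r ≤ s)
    (hn : ¬(i < r ∧ s ≤ a)) : V r ≤ U s := by
  by_cases hr : i < r
  · exact (hV hrs).trans (h.ge s (by omega))
  · exact (h.ge r (by omega)).trans (hU hrs)

variable [FiniteDimensional F E]

theorem le_of_finrank_inf {X Y : Submodule F E} (h : finrank F ↥(X ⊓ Y) = finrank F X) : X ≤ Y :=
  inf_eq_left.1 (Submodule.eq_of_le_of_finrank_eq inf_le_left h)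

theorem sup_eq_of_finrank_eq_add_one {X Y Z : Submodule F E} (hYZ : Y ≤ Z) (hXZ : X ≤ Z)
    (hrank : finrank F Z = finrank F Y + 1) (hXY : ¬X ≤ Y) : Y ⊔ X = Z := by
  have hlt : finrank F Y < finrank F ↥(Y ⊔ X) :=
    Submodule.finrank_lt_finrank_of_lt (left_lt_sup.2 hXY)
  exact Submodule.eq_of_le_of_finrank_le (sup_le hYZ hXZ) (by omega)

theorem finrank_inf_add_one {X Y Z : Submodule F E} (hYZ : Y ≤ Z) (hXZ : X ≤ Z)
    (hrank : finrank F Z = finrank F Y + 1) (hXY : ¬X ≤ Y) :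
    finrank F ↥(X ⊓ Y) + 1 = finrank F X := by
  have hsum := Submodule.finrank_sup_add_finrank_inf_eq X Y
  rw [sup_comm, sup_eq_of_finrank_eq_add_one hYZ hXZ hrank hXY] at hsum
  omega

theorem IsStep.inf_eq (h : IsStep i a V U) (hV : Monotone V) (hU : Monotone U) (hr : i < r)
    (hrs : r ≤ s) (hs : s ≤ a) : V r ⊓ U s = U r := by
  have hlt : finrank F ↥(V r ⊓ U s) < finrank F (V r) :=
    Submodule.finrank_lt_finrank_of_lt (inf_lt_left.2 (h.not_le_of_le hV hU hr hrs hs))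
  have hrank := h.rank r hr (by omega)
  exact (Submodule.eq_of_le_of_finrank_le (le_inf (h.le r) (hU hrs)) (by omega)).symm

theorem IsStep.hasDefect (h : IsStep i a V U) (hV : Monotone V) (hU : Monotone U) :
    HasDefect V U (box i a) := by
  refine ⟨h.le, fun r s hrs => ?_⟩
  by_cases hc : i < r ∧ s ≤ a
  · rw [box_of_pos hc, h.inf_eq hV hU hc.1 hrs hc.2, h.rank r hc.1 (hrs.trans hc.2)]
  · rw [box_of_neg hc, inf_eq_left.2 (h.le_of_not hV hU hrs hc), add_zero]

theorem HasDefect.isStep (h : HasDefect V U (box i a)) : IsStep i a V U where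
  le := h.le
  ge s hs := le_of_finrank_inf (by rw [← h.finrank_inf s s le_rfl, box_of_neg hs, add_zero])
  rank s hi ha := by rw [← h.finrank_eq s, box_of_pos ⟨hi, ha⟩]
  not_le hia := h.not_le hia (by rw [box_of_pos ⟨i.lt_succ_self, le_rfl⟩]; exact one_pos)

theorem isStep_iff_hasDefect (hV : Monotone V) (hU : Monotone U) :
    IsStep i a V U ↔ HasDefect V U (box i a) :=
  ⟨fun h => h.hasDefect hV hU, HasDefect.isStep⟩

theorem IsStep.quasiSplit (h₁ : IsStep i a V U) (h₂ : IsStep j b U W) (hV : Monotone V)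
    (hU : Monotone U) (hW : Monotone W) : QuasiSplit i a j b V W := by
  refine ⟨fun s => (h₂.le s).trans (h₁.le s), fun r s hrs hn => ?_⟩
  have hUW := (h₂.hasDefect hU hW).finrank_inf r s hrs
  by_cases hrect : i < r ∧ s ≤ a
  · have hinf : V r ⊓ W s = U r ⊓ W s := by
      rw [← h₁.inf_eq hV hU hrect.1 hrs hrect.2, inf_assoc, inf_eq_right.2 (h₂.le s)]
    rw [hinf, box_of_pos hrect, h₁.rank r hrect.1 (by omega)]
    omega
  rw [box_of_neg hrect, zero_add]
  by_cases hr : i < r ∧ r ≤ a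
  swap
  · rw [h₁.eq hr, hUW]
  have hVs : V s = U s := h₁.eq (by omega)
  have hVU : V r ≤ U s := (hV hrs).trans hVs.le
  by_cases hbox : j < r ∧ s ≤ b
  · have hnot : ¬V r ≤ W s := fun hle =>
      h₂.not_le_of_le hU hW hbox.1 hrs hbox.2 ((h₁.le r).trans hle)
    rw [box_of_pos hbox]
    exact finrank_inf_add_one (h₂.le s) hVU (h₂.rank s (by omega) hbox.2) hnot
  · have hle : V r ≤ W s := by
      by_cases hs : j < s ∧ s ≤ b
      · have hVj : V j = W j := (h₁.eq (by omega)).trans (h₂.eq (by omega))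
        exact (hV (by omega)).trans (hVj.le.trans (hW hs.1.le))
      · exact hVU.trans (h₂.ge s hs)
    rw [box_of_neg hbox, inf_eq_left.2 hle, add_zero]

theorem IsStep.hasDefect_of_not_le (h₁ : IsStep i a V U) (h₂ : IsStep j b U W) (hV : Monotone V)
    (hU : Monotone U) (hW : Monotone W) (hc : i < j ∧ j ≤ a ∧ a < b) (hnot : ¬V j ≤ W (a + 1)) :
    HasDefect V W fun r s => box i b r s + box j a r s := by
  have h := h₁.quasiSplit h₂ hV hU hW
  refine ⟨h.le, fun r s hrs => ?_⟩
  by_cases hn : i < r ∧ r ≤ j ∧ j ≤ a ∧ a < s ∧ s ≤ b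
  swap
  · rw [← h.finrank_inf r s hrs hn]
    simp only [box]
    split_ifs <;> omega
  have hUj : U j = W j := h₂.eq (by omega)
  have hVa : V (a + 1) = U (a + 1) := h₁.eq (by omega)
  have hinf_j : V j ⊓ W (a + 1) = U j := by
    have hlt : finrank F ↥(V j ⊓ W (a + 1)) < finrank F (V j) :=
      Submodule.finrank_lt_finrank_of_lt (inf_lt_left.2 hnot)
    have hrank := h₁.rank j hc.1 hc.2.1
    exact (Submodule.eq_of_le_of_finrank_le
      (le_inf (h₁.le j) (hUj.le.trans (hW (by omega)))) (by omega)).symm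
  have hinf_a : U (a + 1) ⊓ W s = W (a + 1) := h₂.inf_eq hU hW (by omega) (by omega) (by omega)
  have hVr : V r ≤ V j ⊓ U (a + 1) := le_inf (hV hn.2.1) ((hV (by omega)).trans hVa.le)
  have hinf : V r ⊓ W s = U r := by
    calc V r ⊓ W s = V r ⊓ (V j ⊓ (U (a + 1) ⊓ W s)) := by
          rw [← inf_assoc (V j), ← inf_assoc, inf_eq_left.2 hVr]
      _ = V r ⊓ U j := by rw [hinf_a, hinf_j]
      _ = U r := h₁.inf_eq hV hU hn.1 hn.2.1 hc.2.1
  rw [hinf, box_of_pos (by omega), box_of_neg (by omega), h₁.rank r hn.1 (by omega)]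

theorem IsStep.comp (h₁ : IsStep i a V U) (h₂ : IsStep j b U W) (hV : Monotone V)
    (hU : Monotone U) (hW : Monotone W) :
    HasDefect V W (fun r s => box i a r s + box j b r s) ∨
      (i < j ∧ j ≤ a ∧ a < b) ∧ HasDefect V W (fun r s => box i b r s + box j a r s) := by
  by_cases hc : (i < j ∧ j ≤ a ∧ a < b) ∧ ¬V j ≤ W (a + 1)
  · exact Or.inr ⟨hc.1, h₁.hasDefect_of_not_le h₂ hV hU hW hc.1 hc.2⟩
  · exact Or.inl ((h₁.quasiSplit h₂ hV hU hW).hasDefect_of_le hV hW (by tauto))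

end Chains

section Lines

variable {F E : Type*} [Field F] [AddCommGroup E] [Module F E]

/-- The one-dimensional subspaces of `Y / X`, as subspaces between `X` and `Y`. -/
def lines (X Y : Submodule F E) : Set (Submodule F E) :=
  {L | X ≤ L ∧ L ≤ Y ∧ finrank F L = finrank F X + 1}

variable [FiniteDimensional F E] {X Y L : Submodule F E}

theorem finrank_map_mkQ_add (hXY : X ≤ Y) :
    finrank F ↥(Y.map X.mkQ) + finrank F X = finrank F Y := by
  have hrank := LinearMap.finrank_range_add_finrank_ker (X.mkQ.domRestrict Y)
  rw [LinearMap.range_domRestrict, LinearMap.ker_domRestrict, Submodule.ker_mkQ] at hrank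
  rw [← hrank, ← Submodule.finrank_map_subtype_eq Y (X.comap Y.subtype),
    Submodule.map_comap_subtype, inf_eq_right.2 hXY]

theorem lines_eq_image (hXY : X ≤ Y) :
    lines X Y = (fun S : Submodule F ↥(Y.map X.mkQ) => (S.map (Submodule.subtype _)).comap X.mkQ) ''
      {S | finrank F S = 1} := by
  have hrank (S : Submodule F ↥(Y.map X.mkQ)) :
      finrank F ↥((S.map (Submodule.subtype _)).comap X.mkQ) = finrank F S + finrank F X := by
    rw [← finrank_map_mkQ_add (Submodule.le_comap_mkQ X _),
      Submodule.map_comap_eq_of_surjective X.mkQ_surjective, Submodule.finrank_map_subtype_eq]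
  ext L
  constructor
  · rintro ⟨hXL, hLY, hL⟩
    have hcomap : (((L.map X.mkQ).submoduleOf (Y.map X.mkQ)).map (Submodule.subtype _)).comap X.mkQ
        = L := by
      rw [Submodule.submoduleOf, Submodule.map_comap_subtype,
        inf_eq_right.2 (Submodule.map_mono hLY), Submodule.comap_map_mkQ, sup_eq_right.2 hXL]
    refine ⟨_, ?_, hcomap⟩
    have hL' := hrank ((L.map X.mkQ).submoduleOf (Y.map X.mkQ))
    rw [hcomap, hL, add_comm] at hL'
    exact (Nat.add_right_cancel hL').symm
  · rintro ⟨S, hS : finrank F S = 1, rfl⟩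
    refine ⟨Submodule.le_comap_mkQ X _, ?_, by rw [hrank, hS, add_comm]⟩
    refine (Submodule.comap_mono (Submodule.map_subtype_le _ S)).trans ?_
    rw [Submodule.comap_map_mkQ, sup_eq_right.2 hXY]

theorem ncard_lines [Finite F] (hXY : X ≤ Y) (h : finrank F Y = finrank F X + 2) :
    (lines X Y).ncard = Nat.card F + 1 := by
  have hY : finrank F ↥(Y.map X.mkQ) = 2 := by
    have hadd := finrank_map_mkQ_add hXY
    omega
  rw [lines_eq_image hXY, Set.ncard_image_of_injective,
    ← Projectivization.card_of_finrank_two F _ hY,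
    Nat.card_congr (Projectivization.equivSubmodule F ↥(Y.map X.mkQ))]
  · rfl
  · exact (Submodule.comap_injective_of_surjective X.mkQ_surjective).comp
      (Submodule.map_injective_of_injective (Submodule.injective_subtype _))

theorem eq_of_mem_lines {L' : Submodule F E} (hL : L ∈ lines X Y) (hL' : L' ∈ lines X Y)
    (h : L ≤ L') : L = L' :=
  Submodule.eq_of_le_of_finrank_eq h (hL.2.2.trans hL'.2.2.symm)

end Lines

section Interpolation

variable {F E : Type*} [Field F] [AddCommGroup E] [Module F E]
  {V U W : ℕ → Submodule F E} {i a j b r s : ℕ} {L : Submodule F E}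

/-- The chain between `V` and `W` that is `V` off `i < s ≤ a`, is `W` off `j < s ≤ b` and is spanned
by `W` and `L` on the intersection of the two intervals. -/
def interp (i a j b : ℕ) (V W : ℕ → Submodule F E) (L : Submodule F E) (s : ℕ) : Submodule F E :=
  if i < s ∧ s ≤ a then if j < s ∧ s ≤ b then W s ⊔ L else W s else V s

theorem interp_of_mem_of_mem (hi : i < s ∧ s ≤ a) (hj : j < s ∧ s ≤ b) :
    interp i a j b V W L s = W s ⊔ L := by
  rw [interp, if_pos hi, if_pos hj]

theorem interp_of_mem_of_not (hi : i < s ∧ s ≤ a) (hj : ¬(j < s ∧ s ≤ b)) :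
    interp i a j b V W L s = W s := by
  rw [interp, if_pos hi, if_neg hj]

theorem interp_of_not (hi : ¬(i < s ∧ s ≤ a)) : interp i a j b V W L s = V s :=
  if_neg hi

/-- The conditions on the first space `L` on the intersection of the intervals `i < s ≤ a` and
`j < s ≤ b` for a chain between `V` and `W` to be composed of the steps `(i, a)` and `(j, b)`. -/
structure IsCut (i a j b : ℕ) (V W : ℕ → Submodule F E) (L : Submodule F E) : Prop where
  mem : L ∈ lines (W (max i j + 1)) (V (max i j + 1))
  left_not_le : i < j → ¬V (max i j) ≤ L
  left_le : j < i → V (max i j) ≤ L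
  not_le_right : a < b → ¬L ≤ W (min a b + 1)
  le_right : b < a → L ≤ W (min a b + 1)

theorem IsStep.isCut (h₁ : IsStep i a V U) (h₂ : IsStep j b U W) (hV : Monotone V)
    (hU : Monotone U) (hW : Monotone W) (hov : max i j < min a b) :
    IsCut i a j b V W (U (max i j + 1)) where
  mem := ⟨h₂.le _, h₁.le _, h₂.rank _ (by omega) (by omega)⟩
  left_not_le _ := h₁.not_le_of_le hV hU (by omega) (by omega) (by omega)
  left_le _ := (h₁.ge _ (by omega)).trans (hU (Nat.le_succ _))
  not_le_right _ := h₂.not_le_of_le hU hW (by omega) (by omega) (by omega)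
  le_right _ := (hU (by omega)).trans (h₂.ge _ (by omega))

theorem QuasiSplit.interp_le (h : QuasiSplit i a j b V W) (hV : Monotone V)
    (hL : max i j < min a b → IsCut i a j b V W L) (s : ℕ) : interp i a j b V W L s ≤ V s := by
  unfold interp
  split_ifs with hi hj
  · exact sup_le (h.le s) ((hL (by omega)).mem.2.1.trans (hV (by omega)))
  · exact h.le s
  · exact le_rfl

theorem QuasiSplit.le_interp (h : QuasiSplit i a j b V W) (s : ℕ) :
    W s ≤ interp i a j b V W L s := by
  unfold interp
  split_ifs with hi hj
  · exact le_sup_left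
  · exact le_rfl
  · exact h.le s

variable [FiniteDimensional F E]

theorem IsStep.eq_interp (h₁ : IsStep i a V U) (h₂ : IsStep j b U W) (hU : Monotone U)
    (hW : Monotone W) : U = interp i a j b V W (U (max i j + 1)) := by
  funext s
  unfold interp
  split_ifs with hi hj
  · have hnot : ¬U (max i j + 1) ≤ W s :=
      h₂.not_le_of_le hU hW (by omega) (by omega) hj.2
    exact (sup_eq_of_finrank_eq_add_one (h₂.le s) (hU (by omega)) (h₂.rank s hj.1 hj.2) hnot).symm
  · exact h₂.eq hj
  · exact (h₁.eq hi).symm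

theorem QuasiSplit.le_of_box_eq_zero (h : QuasiSplit i a j b V W) (hrs : r ≤ s)
    (hn : ¬(i < r ∧ r ≤ j ∧ j ≤ a ∧ a < s ∧ s ≤ b))
    (hbox : box i a r s + box j b r s = 0) : V r ≤ W s := by
  refine le_of_finrank_inf ?_
  rw [← h.finrank_inf r s hrs hn, hbox, add_zero]

theorem QuasiSplit.inf_le_of_box_eq (h : QuasiSplit i a j b V W) (hW : Monotone W) {s' : ℕ}
    (hrs : r ≤ s) (hss : s ≤ s') (hn : ¬(i < r ∧ r ≤ j ∧ j ≤ a ∧ a < s ∧ s ≤ b))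
    (hn' : ¬(i < r ∧ r ≤ j ∧ j ≤ a ∧ a < s' ∧ s' ≤ b))
    (hbox : box i a r s + box j b r s = box i a r s' + box j b r s') : V r ⊓ W s' ≤ W s := by
  have hrank := h.finrank_inf r s hrs hn
  have hrank' := h.finrank_inf r s' (hrs.trans hss) hn'
  have hinf : V r ⊓ W s = V r ⊓ W s' :=
    Submodule.eq_of_le_of_finrank_eq (inf_le_inf_left _ (hW hss)) (by omega)
  exact hinf.ge.trans inf_le_right

theorem QuasiSplit.le_sup_of_box_eq (h : QuasiSplit i a j b V W) (hV : Monotone V) {r' : ℕ}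
    (hrr : r' ≤ r) (hrs : r ≤ s) (hn : ¬(i < r ∧ r ≤ j ∧ j ≤ a ∧ a < s ∧ s ≤ b))
    (hn' : ¬(i < r' ∧ r' ≤ j ∧ j ≤ a ∧ a < s ∧ s ≤ b))
    (hbox : box i a r' s + box j b r' s = box i a r s + box j b r s) : V r ≤ V r' ⊔ W s := by
  have hrank := h.finrank_inf r s hrs hn
  have hrank' := h.finrank_inf r' s (hrr.trans hrs) hn'
  have hsum := Submodule.finrank_sup_add_finrank_inf_eq (V r) (W s)
  have hsum' := Submodule.finrank_sup_add_finrank_inf_eq (V r') (W s)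
  have hsup : V r' ⊔ W s = V r ⊔ W s :=
    Submodule.eq_of_le_of_finrank_eq (sup_le_sup_right (hV hrr) _) (by omega)
  exact le_sup_left.trans hsup.ge

theorem QuasiSplit.inf_eq_of_isCut (h : QuasiSplit i a j b V W) (hW : Monotone W)
    (hL : IsCut i a j b V W L) (hi : i < s ∧ s ≤ a) (hj : j < s ∧ s ≤ b) :
    L ⊓ W s = W (max i j + 1) := by
  refine le_antisymm ((inf_le_inf_right _ hL.mem.2.1).trans ?_)
    (le_inf hL.mem.1 (hW (by omega)))
  refine h.inf_le_of_box_eq hW le_rfl (by omega) (by omega) (by omega) ?_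
  rw [box_of_pos (by omega), box_of_pos (by omega), box_of_pos (by omega), box_of_pos (by omega)]

theorem QuasiSplit.finrank_sup_of_isCut (h : QuasiSplit i a j b V W) (hW : Monotone W)
    (hL : IsCut i a j b V W L) (hi : i < s ∧ s ≤ a) (hj : j < s ∧ s ≤ b) :
    finrank F ↥(W s ⊔ L) = finrank F (W s) + 1 := by
  have hsum := Submodule.finrank_sup_add_finrank_inf_eq (W s) L
  rw [inf_comm, h.inf_eq_of_isCut hW hL hi hj, hL.mem.2.2] at hsum
  omega

theorem QuasiSplit.monotone_interp (h : QuasiSplit i a j b V W) (hV : Monotone V)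
    (hW : Monotone W) (hL : max i j < min a b → IsCut i a j b V W L) :
    Monotone (interp i a j b V W L) := by
  refine monotone_nat_of_le_succ fun s => ?_
  by_cases hi' : i < s + 1 ∧ s + 1 ≤ a
  swap
  · rw [interp_of_not hi']
    exact (h.interp_le hV hL s).trans (hV s.le_succ)
  have hWW : W s ≤ interp i a j b V W L (s + 1) := (hW s.le_succ).trans (h.le_interp _)
  by_cases hi : i < s ∧ s ≤ a
  · by_cases hj : j < s ∧ s ≤ b
    · rw [interp_of_mem_of_mem hi hj]
      refine sup_le hWW ?_
      by_cases hj' : s + 1 ≤ b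
      · rw [interp_of_mem_of_mem hi' (by omega)]
        exact le_sup_right
      · exact ((hL (by omega)).le_right (by omega)).trans ((hW (by omega)).trans (h.le_interp _))
    · rwa [interp_of_mem_of_not hi hj]
  · rw [interp_of_not hi]
    by_cases hj : j < s ∧ s + 1 ≤ b
    · rw [interp_of_mem_of_mem hi' (by omega)]
      exact (hV (by omega)).trans (((hL (by omega)).left_le (by omega)).trans le_sup_right)
    · refine le_trans (h.le_of_box_eq_zero s.le_succ (by omega) ?_) (h.le_interp _)
      rw [box_of_neg (by omega), box_of_neg (by omega)]

theorem QuasiSplit.not_le_interp (h : QuasiSplit i a j b V W) (hV : Monotone V)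
    (hW : Monotone W) (hL : max i j < min a b → IsCut i a j b V W L) (hia : i < a) :
    ¬V (i + 1) ≤ interp i a j b V W L a := by
  by_cases hj : j < a ∧ a ≤ b
  swap
  · rw [interp_of_mem_of_not ⟨hia, le_rfl⟩ hj]
    refine h.not_le hia (by omega) ?_
    rw [box_of_pos (by omega)]
    omega
  rw [interp_of_mem_of_mem ⟨hia, le_rfl⟩ hj]
  intro hle
  have hcut := hL (by omega)
  have hVL : V (i + 1) ≤ L := by
    calc V (i + 1) ≤ (L ⊔ W a) ⊓ V (max i j + 1) := le_inf (sup_comm L _ ▸ hle) (hV (by omega))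
      _ = L ⊔ W a ⊓ V (max i j + 1) := sup_inf_assoc_of_le _ hcut.mem.2.1
      _ ≤ L := by
        refine sup_le le_rfl (le_trans ?_ hcut.mem.1)
        rw [inf_comm]
        refine h.inf_le_of_box_eq hW le_rfl (by omega) (by omega) (by omega) ?_
        rw [box_of_pos (by omega), box_of_pos (by omega), box_of_pos (by omega),
          box_of_pos (by omega)]
  rcases le_or_gt j i with hji | hij
  · have hrank := h.finrank_eq (i + 1)
    have hLrank := hcut.mem.2.2
    rw [box_of_pos (by omega), box_of_pos (by omega)] at hrank
    rw [max_eq_left hji] at hLrank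
    have hmono := Submodule.finrank_mono hVL
    omega
  · refine hcut.left_not_le hij (le_trans ?_ (sup_le hVL hcut.mem.1))
    refine h.le_sup_of_box_eq hV (by omega) (Nat.le_succ _) (by omega) (by omega) ?_
    rw [box_of_pos (by omega), box_of_neg (by omega), box_of_pos (by omega), box_of_neg (by omega)]

theorem QuasiSplit.not_interp_le (h : QuasiSplit i a j b V W) (hW : Monotone W)
    (hL : max i j < min a b → IsCut i a j b V W L) (hjb : j < b) :
    ¬interp i a j b V W L (j + 1) ≤ W b := by
  by_cases hi : i < j + 1 ∧ j + 1 ≤ a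
  swap
  · rw [interp_of_not hi]
    refine h.not_le hjb (by omega) ?_
    rw [box_of_pos (k := j) (by omega)]
    omega
  rw [interp_of_mem_of_mem hi (by omega)]
  intro hle
  have hcut := hL (by omega)
  have hLrank := hcut.mem.2.2
  have hLV : L ≤ V (max i j + 1) ⊓ W b := le_inf hcut.mem.2.1 (le_sup_right.trans hle)
  rcases le_or_gt b a with hba | hab
  · have hLW : L ≤ W (max i j + 1) := by
      refine hLV.trans (h.inf_le_of_box_eq hW le_rfl (by omega) (by omega) (by omega) ?_)
      rw [box_of_pos (by omega), box_of_pos (by omega), box_of_pos (by omega),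
        box_of_pos (by omega)]
    have hmono := Submodule.finrank_mono hLW
    omega
  · refine hcut.not_le_right hab (hLV.trans ?_)
    refine h.inf_le_of_box_eq hW (by omega) (by omega) (by omega) (by omega) ?_
    rw [box_of_neg (by omega), box_of_pos (by omega), box_of_neg (by omega), box_of_pos (by omega)]

theorem QuasiSplit.isStep_interp_left (h : QuasiSplit i a j b V W) (hV : Monotone V)
    (hW : Monotone W) (hL : max i j < min a b → IsCut i a j b V W L) :
    IsStep i a V (interp i a j b V W L) where
  le := h.interp_le hV hL
  ge s hs := by rw [interp_of_not hs]
  rank s hi ha := by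
    have hrank := h.finrank_eq s
    rw [box_of_pos ⟨hi, ha⟩] at hrank
    by_cases hj : j < s ∧ s ≤ b
    · rw [box_of_pos hj] at hrank
      rw [interp_of_mem_of_mem ⟨hi, ha⟩ hj,
        h.finrank_sup_of_isCut hW (hL (by omega)) ⟨hi, ha⟩ hj, ← hrank]
    · rw [box_of_neg hj] at hrank
      rw [interp_of_mem_of_not ⟨hi, ha⟩ hj, ← hrank]
  not_le := h.not_le_interp hV hW hL

theorem QuasiSplit.isStep_interp_right (h : QuasiSplit i a j b V W) (hW : Monotone W)
    (hL : max i j < min a b → IsCut i a j b V W L) :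
    IsStep j b (interp i a j b V W L) W where
  le := h.le_interp
  ge s hs := by
    unfold interp
    split_ifs with hi
    · exact le_rfl
    · exact h.le_of_box_eq_zero le_rfl (by omega) (by rw [box_of_neg hi, box_of_neg hs])
  rank s hj hb := by
    by_cases hi : i < s ∧ s ≤ a
    · rw [interp_of_mem_of_mem hi ⟨hj, hb⟩]
      exact h.finrank_sup_of_isCut hW (hL (by omega)) hi ⟨hj, hb⟩
    · rw [interp_of_not hi, ← h.finrank_eq s, box_of_neg hi, box_of_pos ⟨hj, hb⟩]
  not_le := h.not_interp_le hW hL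

end Interpolation

section Counting

variable {F E : Type*} [Field F] [AddCommGroup E] [Module F E]
  {V W : ℕ → Submodule F E} {i a j b : ℕ} {L : Submodule F E}

/-- The chains `U` such that `V → U → W` consists of the steps `(i, a)` and `(j, b)`. -/
def midChains (i a j b : ℕ) (V W : ℕ → Submodule F E) : Set (ℕ → Submodule F E) :=
  {U | Monotone U ∧ IsStep i a V U ∧ IsStep j b U W}

/-- The line cut out by `V` at the place where the intersection of the intervals `i < s ≤ a` and
`j < s ≤ b` begins. -/
def leftLine (i j : ℕ) (V W : ℕ → Submodule F E) : Submodule F E :=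
  W (max i j + 1) ⊔ V (max i j)

/-- The line cut out by `W` at the place where the intersection of the intervals `i < s ≤ a` and
`j < s ≤ b` ends. -/
def rightLine (i a j b : ℕ) (V W : ℕ → Submodule F E) : Submodule F E :=
  V (max i j + 1) ⊓ W (min a b + 1)

theorem QuasiSplit.rightLine_mem_lines (h : QuasiSplit i a j b V W) (hW : Monotone W)
    (hov : max i j < min a b) (hab : a ≠ b) :
    rightLine i a j b V W ∈ lines (W (max i j + 1)) (V (max i j + 1)) := by
  refine ⟨le_inf (h.le _) (hW (by omega)), inf_le_left, ?_⟩
  have hrank := h.finrank_eq (max i j + 1)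
  have hinf : finrank F ↥(rightLine i a j b V W) + _ = _ :=
    h.finrank_inf (max i j + 1) (min a b + 1) (by omega) (by omega)
  simp only [box] at hrank hinf
  split_ifs at hrank hinf <;> omega

theorem QuasiSplit.ncard_lines [FiniteDimensional F E] [Finite F] (h : QuasiSplit i a j b V W)
    (hov : max i j < min a b) :
    (lines (W (max i j + 1)) (V (max i j + 1))).ncard = Nat.card F + 1 := by
  refine BLM.ncard_lines (h.le _) ?_
  rw [← h.finrank_eq (max i j + 1), box_of_pos (by omega), box_of_pos (by omega)]

variable [FiniteDimensional F E]

theorem QuasiSplit.leftLine_mem_lines (h : QuasiSplit i a j b V W) (hV : Monotone V)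
    (hov : max i j < min a b) (hij : i ≠ j) :
    leftLine i j V W ∈ lines (W (max i j + 1)) (V (max i j + 1)) := by
  refine ⟨le_sup_left, sup_le (h.le _) (hV (Nat.le_succ _)), ?_⟩
  have hsum := Submodule.finrank_sup_add_finrank_inf_eq (V (max i j)) (W (max i j + 1))
  have hinf := h.finrank_inf (max i j) (max i j + 1) (Nat.le_succ _) (by omega)
  rw [leftLine, sup_comm]
  simp only [box] at hinf
  split_ifs at hinf <;> omega

theorem QuasiSplit.le_iff_eq_leftLine (h : QuasiSplit i a j b V W) (hV : Monotone V)
    (hov : max i j < min a b) (hij : i ≠ j)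
    (hL : L ∈ lines (W (max i j + 1)) (V (max i j + 1))) :
    V (max i j) ≤ L ↔ L = leftLine i j V W :=
  ⟨fun hle => (eq_of_mem_lines (h.leftLine_mem_lines hV hov hij) hL (sup_le hL.1 hle)).symm,
    fun he => he ▸ le_sup_right⟩

theorem QuasiSplit.le_iff_eq_rightLine (h : QuasiSplit i a j b V W) (hW : Monotone W)
    (hov : max i j < min a b) (hab : a ≠ b)
    (hL : L ∈ lines (W (max i j + 1)) (V (max i j + 1))) :
    L ≤ W (min a b + 1) ↔ L = rightLine i a j b V W :=
  ⟨fun hle => eq_of_mem_lines hL (h.rightLine_mem_lines hW hov hab) (le_inf hL.2.1 hle),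
    fun he => he ▸ inf_le_right⟩

theorem QuasiSplit.leftLine_eq_rightLine_iff (h : QuasiSplit i a j b V W) (hV : Monotone V)
    (hW : Monotone W) (hov : max i j < min a b) (hij : i ≠ j) (hab : a ≠ b) :
    leftLine i j V W = rightLine i a j b V W ↔ V (max i j) ≤ W (min a b + 1) := by
  rw [← h.le_iff_eq_rightLine hW hov hab (h.leftLine_mem_lines hV hov hij), leftLine, sup_le_iff]
  exact and_iff_right (hW (by omega))

theorem QuasiSplit.ncard_midChains_of_le (h : QuasiSplit i a j b V W) (hV : Monotone V)
    (hW : Monotone W) (hov : min a b ≤ max i j) : (midChains i a j b V W).ncard = 1 := by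
  have hL : max i j < min a b → IsCut i a j b V W ⊥ := fun hlt => absurd hov hlt.not_ge
  rw [Set.ncard_eq_one]
  refine ⟨interp i a j b V W ⊥, Set.eq_singleton_iff_unique_mem.2 ⟨⟨h.monotone_interp hV hW hL,
    h.isStep_interp_left hV hW hL, h.isStep_interp_right hW hL⟩, ?_⟩⟩
  rintro U ⟨hU, h₁, h₂⟩
  rw [h₁.eq_interp h₂ hU hW]
  funext s
  unfold interp
  split_ifs
  · omega
  · rfl
  · rfl

theorem QuasiSplit.ncard_midChains_of_lt (h : QuasiSplit i a j b V W) (hV : Monotone V)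
    (hW : Monotone W) (hov : max i j < min a b) :
    (midChains i a j b V W).ncard = {L | IsCut i a j b V W L}.ncard := by
  refine Set.ncard_congr (fun U _ => U (max i j + 1)) ?_ ?_ ?_
  · rintro U ⟨hU, h₁, h₂⟩
    exact h₁.isCut h₂ hV hU hW hov
  · rintro U U' ⟨hU, h₁, h₂⟩ ⟨hU', h₁', h₂'⟩ he
    rw [h₁.eq_interp h₂ hU hW, h₁'.eq_interp h₂' hU' hW]
    exact congrArg _ he
  · intro L hL
    refine ⟨interp i a j b V W L, ⟨h.monotone_interp hV hW fun _ => hL,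
      h.isStep_interp_left hV hW fun _ => hL, h.isStep_interp_right hW fun _ => hL⟩, ?_⟩
    rw [interp_of_mem_of_mem (by omega) (by omega), sup_eq_right.2 hL.mem.1]

theorem QuasiSplit.ncard_setOf_isCut_of_gt (h : QuasiSplit i a j b V W) (hV : Monotone V)
    (hW : Monotone W) (hov : max i j < min a b) (hgt : j < i ∨ b < a)
    (hiff : i ≠ j → a ≠ b → (V (max i j) ≤ W (min a b + 1) ↔ (i < j ↔ a < b))) :
    {L | IsCut i a j b V W L}.ncard = 1 := by
  rw [Set.ncard_eq_one]
  by_cases hij : j < i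
  · have hmem := h.leftLine_mem_lines hV hov hij.ne'
    have hle (hab : a ≠ b) : leftLine i j V W ≤ W (min a b + 1) ↔ (i < j ↔ a < b) := by
      rw [h.le_iff_eq_rightLine hW hov hab hmem,
        h.leftLine_eq_rightLine_iff hV hW hov hij.ne' hab, hiff hij.ne' hab]
    refine ⟨leftLine i j V W, Set.eq_singleton_iff_unique_mem.2 ⟨⟨hmem, fun hlt => by omega,
      fun _ => le_sup_right, fun hlt => ?_, fun hlt => ?_⟩, fun L hL => ?_⟩⟩
    · rw [hle hlt.ne]
      omega
    · rw [hle hlt.ne']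
      omega
    · exact (h.le_iff_eq_leftLine hV hov hij.ne' hL.mem).1 (hL.left_le hij)
  · have hab : b < a := hgt.resolve_left hij
    have hmem := h.rightLine_mem_lines hW hov hab.ne'
    refine ⟨rightLine i a j b V W, Set.eq_singleton_iff_unique_mem.2 ⟨⟨hmem, fun hlt => ?_,
      fun hlt => absurd hlt hij, fun hlt => by omega, fun _ => inf_le_right⟩, fun L hL => ?_⟩⟩
    · rw [h.le_iff_eq_leftLine hV hov hlt.ne hmem, eq_comm,
        h.leftLine_eq_rightLine_iff hV hW hov hlt.ne hab.ne', hiff hlt.ne hab.ne']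
      omega
    · exact (h.le_iff_eq_rightLine hW hov hab.ne' hL.mem).1 (hL.le_right hab)

theorem QuasiSplit.ncard_setOf_isCut_of_le [Finite F] (h : QuasiSplit i a j b V W)
    (hV : Monotone V) (hW : Monotone W) (hov : max i j < min a b) (hij : i ≤ j) (hab : a ≤ b) :
    {L | IsCut i a j b V W L}.ncard = Nat.card F + 1 -
      {L | i < j ∧ L = leftLine i j V W ∨ a < b ∧ L = rightLine i a j b V W}.ncard := by
  have hdiff : {L | IsCut i a j b V W L} = lines (W (max i j + 1)) (V (max i j + 1)) \
      {L | i < j ∧ L = leftLine i j V W ∨ a < b ∧ L = rightLine i a j b V W} := by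
    ext L
    constructor
    · rintro hL
      refine ⟨hL.mem, ?_⟩
      rintro (⟨hlt, he⟩ | ⟨hlt, he⟩)
      · exact hL.left_not_le hlt ((h.le_iff_eq_leftLine hV hov hlt.ne hL.mem).2 he)
      · exact hL.not_le_right hlt ((h.le_iff_eq_rightLine hW hov hlt.ne hL.mem).2 he)
    · rintro ⟨hmem, hL⟩
      exact ⟨hmem,
        fun hlt hle => hL (Or.inl ⟨hlt, (h.le_iff_eq_leftLine hV hov hlt.ne hmem).1 hle⟩),
        fun hlt => absurd hlt hij.not_gt,
        fun hlt hle => hL (Or.inr ⟨hlt, (h.le_iff_eq_rightLine hW hov hlt.ne hmem).1 hle⟩),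
        fun hlt => absurd hlt hab.not_gt⟩
  have hfinite : {L | i < j ∧ L = leftLine i j V W ∨
      a < b ∧ L = rightLine i a j b V W}.Finite :=
    (Set.toFinite {leftLine i j V W, rightLine i a j b V W}).subset fun L hL =>
      hL.imp And.right And.right
  rw [hdiff, Set.ncard_sdiff _ hfinite, h.ncard_lines hov]
  rintro L (⟨hlt, rfl⟩ | ⟨hlt, rfl⟩)
  · exact h.leftLine_mem_lines hV hov hlt.ne
  · exact h.rightLine_mem_lines hW hov hlt.ne

theorem HasDefect.le_iff_of_split (h : HasDefect V W fun r s => box i a r s + box j b r s)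
    (hov : max i j < min a b) (hij : i ≠ j) (hab : a ≠ b) :
    V (max i j) ≤ W (min a b + 1) ↔ (i < j ↔ a < b) := by
  have hrank : finrank F ↥(V (max i j) ⊓ W (min a b + 1)) +
      (box i a (max i j) (min a b + 1) + box j b (max i j) (min a b + 1)) =
        finrank F (V (max i j)) := h.finrank_inf (max i j) (min a b + 1) (by omega)
  have hbox : box i a (max i j) (min a b + 1) + box j b (max i j) (min a b + 1) = 0 ↔
      (i < j ↔ a < b) := by
    grind [box]
  rw [← hbox]
  refine ⟨fun hle => ?_, fun hzero => le_of_finrank_inf (by rwa [hzero] at hrank)⟩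
  rw [inf_eq_left.2 hle] at hrank
  omega

theorem HasDefect.ncard_midChains_of_split [Finite F]
    (hd : HasDefect V W fun r s => box i a r s + box j b r s) (hV : Monotone V)
    (hW : Monotone W) :
    (midChains i a j b V W).ncard =
      if i = j ∧ a = b ∧ i < a then Nat.card F + 1
      else if i ≤ j ∧ j < a ∧ a ≤ b then Nat.card F else 1 := by
  have h := hd.quasiSplit
  rcases le_or_gt (min a b) (max i j) with hov | hov
  · rw [h.ncard_midChains_of_le hV hW hov, if_neg (by omega), if_neg (by omega)]
  rw [h.ncard_midChains_of_lt hV hW hov]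
  by_cases hgt : j < i ∨ b < a
  · rw [if_neg (by omega), if_neg (by omega)]
    exact h.ncard_setOf_isCut_of_gt hV hW hov hgt (hd.le_iff_of_split hov)
  rw [h.ncard_setOf_isCut_of_le hV hW hov (by omega) (by omega)]
  by_cases heq : i = j ∧ a = b
  · simp [heq, show j < b by omega]
  have hsingleton : ∃ x, {L | i < j ∧ L = leftLine i j V W ∨ a < b ∧ L = rightLine i a j b V W} =
      {x} := by
    rcases eq_or_ne i j with hij | hij
    · exact ⟨rightLine i a j b V W, by ext L; simp [hij, show a < b by omega]⟩
    rcases eq_or_ne a b with hab | hab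
    · exact ⟨leftLine i j V W, by ext L; simp [hab, show i < j by omega]⟩
    have hline : leftLine i j V W = rightLine i a j b V W := by
      rw [h.leftLine_eq_rightLine_iff hV hW hov hij hab, hd.le_iff_of_split hov hij hab]
      omega
    exact ⟨leftLine i j V W, by
      ext L; simp [hline, show i < j by omega, show a < b by omega]⟩
  obtain ⟨x, hx⟩ := hsingleton
  rw [hx, Set.ncard_singleton, if_neg (by omega), if_pos (by omega), Nat.add_sub_cancel]

theorem HasDefect.ncard_midChains_of_crossing [Finite F]
    (hd : HasDefect V W fun r s => box i b r s + box j a r s) (hc : i < j ∧ j ≤ a ∧ a < b)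
    (hV : Monotone V) (hW : Monotone W) :
    (midChains i a j b V W).ncard = if j < a then Nat.card F - 1 else 1 := by
  have h := hd.quasiSplit_of_crossing hc
  rcases le_or_gt (min a b) (max i j) with hov | hov
  · rw [h.ncard_midChains_of_le hV hW hov, if_neg (by omega)]
  have hne : leftLine i j V W ≠ rightLine i a j b V W := by
    rw [Ne, h.leftLine_eq_rightLine_iff hV hW hov (by omega) (by omega)]
    refine hd.not_le (by omega) ?_
    rw [box_of_pos (by omega)]
    omega
  have hpair : {L | i < j ∧ L = leftLine i j V W ∨ a < b ∧ L = rightLine i a j b V W} =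
      {leftLine i j V W, rightLine i a j b V W} := by
    ext L
    simp [hc.1, hc.2.2]
  rw [h.ncard_midChains_of_lt hV hW hov,
    h.ncard_setOf_isCut_of_le hV hW hov hc.1.le hc.2.2.le, hpair, Set.ncard_pair hne,
    if_pos (by omega)]
  omega

end Counting

/-! ### Relative positions of flags -/

section Sums

variable {ι κ R M : Type*} [Fintype ι] [DecidableEq ι] [Zero R] [AddCommMonoid M]

theorem sum_sum_single [Fintype κ] [DecidableEq κ] (f : ι → κ → R → M)
    (hf : ∀ k l, f k l 0 = 0) (i : ι) (a : κ) (c : R) :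
    ∑ k, ∑ l, f k l (Matrix.single i a c k l) = f i a c := by
  simp [Matrix.single_apply, apply_ite (f _ _), hf, ite_and]

theorem sum_sum_diagonal (f : ι → ι → R → M) (hf : ∀ k l, f k l 0 = 0) (ν : ι → R) :
    ∑ k, ∑ l, f k l (Matrix.diagonal ν k l) = ∑ k, f k k (ν k) := by
  simp [Matrix.diagonal_apply, apply_ite (f _ _), hf]

end Sums

section CornerSums

variable {n : ℕ}

/-- The sum of the entries in the first `r` rows and the first `s` columns. For the relative
position of two flags it is the dimension of the intersection of their steps `r` and `s`. -/
def cornerSum (C : Matrix (Fin n) (Fin n) ℕ) (r s : ℕ) : ℕ :=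
  ∑ k : Fin n, ∑ l : Fin n, if (k : ℕ) < r ∧ (l : ℕ) < s then C k l else 0

/-- The sum of the first `s` entries of a vector: the dimension of step `s` of a flag whose graded
pieces have these dimensions. -/
def partialSum (ν : Fin n → ℕ) (s : ℕ) : ℕ := ∑ k : Fin n, if (k : ℕ) < s then ν k else 0

theorem cornerSum_add (C D : Matrix (Fin n) (Fin n) ℕ) (r s : ℕ) :
    cornerSum (C + D) r s = cornerSum C r s + cornerSum D r s := by
  simp only [cornerSum, Matrix.add_apply, ite_add_zero, Finset.sum_add_distrib]

theorem cornerSum_min (C : Matrix (Fin n) (Fin n) ℕ) (r s : ℕ) :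
    cornerSum C (min r n) (min s n) = cornerSum C r s := by
  simp [cornerSum]

theorem cornerSum_zero_left (C : Matrix (Fin n) (Fin n) ℕ) (s : ℕ) : cornerSum C 0 s = 0 := by
  simp [cornerSum]

theorem cornerSum_zero_right (C : Matrix (Fin n) (Fin n) ℕ) (r : ℕ) : cornerSum C r 0 = 0 := by
  simp [cornerSum]

theorem cornerSum_single (i a : Fin n) (c r s : ℕ) :
    cornerSum (Matrix.single i a c) r s = if (i : ℕ) < r ∧ (a : ℕ) < s then c else 0 :=
  sum_sum_single (fun (k l : Fin n) x => if (k : ℕ) < r ∧ (l : ℕ) < s then x else 0) (by simp) i a c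

theorem cornerSum_diagonal (ν : Fin n → ℕ) (r s : ℕ) :
    cornerSum (Matrix.diagonal ν) r s = partialSum ν (min r s) := by
  simp only [partialSum, lt_min_iff]
  exact sum_sum_diagonal (fun (k l : Fin n) x => if (k : ℕ) < r ∧ (l : ℕ) < s then x else 0)
    (by simp) ν

theorem apply_add_cornerSum (C : Matrix (Fin n) (Fin n) ℕ) (i j : Fin n) :
    C i j + cornerSum C i (j + 1) + cornerSum C (i + 1) j =
      cornerSum C (i + 1) (j + 1) + cornerSum C i j := by
  have happly : C i j = ∑ k, ∑ l, if k = i ∧ l = j then C k l else 0 := by simp [ite_and]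
  rw [happly]
  simp only [cornerSum, ← Finset.sum_add_distrib]
  refine Finset.sum_congr rfl fun k _ => Finset.sum_congr rfl fun l _ => ?_
  simp only [Fin.ext_iff]
  split_ifs <;> omega

/-- The matrix `E_{ia} + E_{jb} + diag ν`. All relative positions of flags and all basis elements
that enter products of two generators have this form. -/
def pairMatrix {R : Type*} [AddMonoidWithOne R] (i a j b : Fin n) (ν : Fin n → R) :
    Matrix (Fin n) (Fin n) R :=
  Matrix.single i a 1 + Matrix.single j b 1 + Matrix.diagonal ν

theorem cornerSum_pairMatrix (i a j b : Fin n) (ν : Fin n → ℕ) (r s : ℕ) :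
    cornerSum (pairMatrix i a j b ν) r s = (if (i : ℕ) < r ∧ (a : ℕ) < s then 1 else 0) +
      (if (j : ℕ) < r ∧ (b : ℕ) < s then 1 else 0) + partialSum ν (min r s) := by
  rw [pairMatrix, cornerSum_add, cornerSum_add, cornerSum_single, cornerSum_single,
    cornerSum_diagonal]

variable {i a j b : Fin n} {r s : ℕ}

theorem cornerSum_pairMatrix_add_box (i a j b : Fin n) (ν : Fin n → ℕ) (hrs : r ≤ s) :
    cornerSum (pairMatrix i a j b ν) r s + (box i a r s + box j b r s) =
      (if (i : ℕ) < r then 1 else 0) + (if (j : ℕ) < r then 1 else 0) + partialSum ν r := by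
  rw [cornerSum_pairMatrix, min_eq_left hrs]
  simp only [box]
  split_ifs <;> omega

theorem cornerSum_pairMatrix_of_le (hia : i ≤ a) (hjb : j ≤ b) (ν : Fin n → ℕ) (hsr : s ≤ r) :
    cornerSum (pairMatrix i a j b ν) r s = cornerSum (pairMatrix i a j b ν) s s := by
  rw [Fin.le_def] at hia hjb
  simp only [cornerSum_pairMatrix, min_eq_right hsr, min_self]
  congr 2 <;> exact if_congr (by omega) rfl rfl

end CornerSums

section Flags

variable {F : Type} [Field F] {n d : ℕ}

/-- A flag as a chain of subspaces indexed by all natural numbers, constant from `n` on. -/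
def Flag.chain (V : Flag F n d) (s : ℕ) : Submodule F (Fin d → F) :=
  V.space ⟨min s n, by omega⟩

theorem Flag.monotone_chain (V : Flag F n d) : Monotone V.chain := fun _ _ hrs =>
  Fin.monotone_iff_le_succ.2 V.le_succ (Fin.mk_le_mk.2 (by omega))

theorem Flag.chain_zero (V : Flag F n d) : V.chain 0 = ⊥ := by
  rw [← V.space_zero]
  exact congrArg V.space (Fin.ext (by simp))

theorem Flag.chain_of_le (V : Flag F n d) {s : ℕ} (hs : n ≤ s) : V.chain s = ⊤ := by
  rw [← V.space_last]
  exact congrArg V.space (Fin.ext (by simpa using hs))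

theorem Flag.chain_min (V : Flag F n d) (s : ℕ) : V.chain (min s n) = V.chain s :=
  congrArg V.space (Fin.ext (by simp))

theorem Flag.chain_val (V : Flag F n d) (s : Fin (n + 1)) : V.chain s = V.space s :=
  congrArg V.space (Fin.ext (min_eq_left s.is_le))

theorem Flag.chain_castSucc (V : Flag F n d) (i : Fin n) : V.chain i = V.space i.castSucc :=
  V.chain_val i.castSucc

theorem Flag.chain_succ (V : Flag F n d) (i : Fin n) : V.chain (i + 1) = V.space i.succ :=
  V.chain_val i.succ

theorem Flag.chain_injective : Function.Injective (Flag.chain : Flag F n d → _) := by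
  rintro ⟨V, _, _, _⟩ ⟨W, _, _, _⟩ h
  congr 1
  funext s
  simpa only [Flag.chain_val] using congrFun h s

/-- A monotone chain with `U 0 = ⊥` and `U n = ⊤`, as a flag. -/
def Flag.ofChain (U : ℕ → Submodule F (Fin d → F)) (hU : Monotone U) (hbot : U 0 = ⊥)
    (htop : U n = ⊤) : Flag F n d where
  space s := U s
  le_succ i := hU (by simp)
  space_zero := hbot
  space_last := htop

theorem Flag.chain_ofChain {U : ℕ → Submodule F (Fin d → F)} (hU : Monotone U) (hbot : U 0 = ⊥)
    (htop : U n = ⊤) : (Flag.ofChain U hU hbot htop).chain = U := by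
  funext s
  change U (min s n) = U s
  rcases le_total s n with hs | hs
  · rw [min_eq_left hs]
  · rw [min_eq_right hs, htop, eq_comm, eq_top_iff, ← htop]
    exact hU hs

theorem finrank_quotient_submoduleOf {E : Type*} [AddCommGroup E] [Module F E]
    [FiniteDimensional F E] {X Y : Submodule F E} (h : X ≤ Y) :
    finrank F (Y ⧸ X.submoduleOf Y) + finrank F X = finrank F Y := by
  rw [← Submodule.finrank_quotient_add_finrank (X.submoduleOf Y),
    ← Submodule.finrank_map_subtype_eq Y (X.submoduleOf Y), Submodule.submoduleOf,
    Submodule.map_comap_subtype, inf_eq_right.2 h]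

theorem relPos_apply_add_finrank (V W : Flag F n d) (i j : Fin n) :
    relPos V W i j + finrank F ↥(V.chain i ⊓ W.chain (j + 1)) +
        finrank F ↥(V.chain (i + 1) ⊓ W.chain j) =
      finrank F ↥(V.chain (i + 1) ⊓ W.chain (j + 1)) + finrank F ↥(V.chain i ⊓ W.chain j) := by
  have hV : V.chain i ≤ V.chain (i + 1) := V.monotone_chain (Nat.le_succ _)
  have hW : W.chain j ≤ W.chain (j + 1) := W.monotone_chain (Nat.le_succ _)
  have hquot : relPos V W i j + finrank F ↥(V.chain i ⊔ V.chain (i + 1) ⊓ W.chain j) =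
      finrank F ↥(V.chain i ⊔ V.chain (i + 1) ⊓ W.chain (j + 1)) := by
    have h := finrank_quotient_submoduleOf
      (sup_le_sup_left (inf_le_inf_left (V.chain (i + 1)) hW) (V.chain i))
    rw [V.chain_castSucc, W.chain_castSucc, V.chain_succ, W.chain_succ] at h ⊢
    exact h
  have hsup (t : ℕ) : finrank F ↥(V.chain i ⊔ V.chain (i + 1) ⊓ W.chain t) +
      finrank F ↥(V.chain i ⊓ W.chain t) =
        finrank F (V.chain i) + finrank F ↥(V.chain (i + 1) ⊓ W.chain t) := by
    rw [← Submodule.finrank_sup_add_finrank_inf_eq (V.chain i), ← inf_assoc, inf_eq_left.2 hV]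
  linarith [hsup j, hsup (j + 1)]

theorem finrank_chain_inf_chain (V W : Flag F n d) (r s : ℕ) :
    finrank F ↥(V.chain r ⊓ W.chain s) = cornerSum (relPos V W) r s := by
  suffices h : ∀ r ≤ n, ∀ s ≤ n,
      finrank F ↥(V.chain r ⊓ W.chain s) = cornerSum (relPos V W) r s by
    rw [← V.chain_min, ← W.chain_min, h _ (min_le_right r n) _ (min_le_right s n), cornerSum_min]
  intro r
  induction r with
  | zero =>
    intro _ s _
    rw [V.chain_zero, bot_inf_eq, finrank_bot, cornerSum_zero_left]
  | succ r ihr =>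
    intro hr s
    induction s with
    | zero => rw [W.chain_zero, inf_bot_eq, finrank_bot, cornerSum_zero_right]; simp
    | succ s ihs =>
      intro hs
      have hfinrank := relPos_apply_add_finrank V W ⟨r, hr⟩ ⟨s, hs⟩
      have hcorner := apply_add_cornerSum (relPos V W) ⟨r, hr⟩ ⟨s, hs⟩
      rw [ihr (by omega) (s + 1) hs, ihr (by omega) s (by omega), ihs (by omega)] at hfinrank
      linarith

theorem relPos_eq_iff (V W : Flag F n d) (C : Matrix (Fin n) (Fin n) ℕ) :
    relPos V W = C ↔ ∀ r s, finrank F ↥(V.chain r ⊓ W.chain s) = cornerSum C r s := by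
  refine ⟨fun h => h ▸ finrank_chain_inf_chain V W, fun h => ?_⟩
  ext i j
  have hfinrank := relPos_apply_add_finrank V W i j
  simp only [h] at hfinrank
  linarith [apply_add_cornerSum C i j]

end Flags

section StepsOfFlags

variable {F : Type} [Field F] {n d : ℕ} {i a j b : Fin n} {ν : Fin n → ℕ}

/-- The dimensions in a chain whose graded pieces have dimensions `e_i + e_j + ν`, where `e_i` is
the unit vector. -/
def HasDims (V : ℕ → Submodule F (Fin d → F)) (i j : Fin n) (ν : Fin n → ℕ) : Prop :=
  ∀ s, finrank F (V s) =
    (if (i : ℕ) < s then 1 else 0) + (if (j : ℕ) < s then 1 else 0) + partialSum ν s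

theorem hasDims_of_relPos_eq {V W : Flag F n d}
    (h : relPos V W = pairMatrix i a j b ν) : HasDims V.chain i j ν := fun s => by
  have hcorner := (relPos_eq_iff V W _).1 h s (max s n)
  rw [W.chain_of_le (le_max_right s n), inf_top_eq] at hcorner
  rw [hcorner, ← cornerSum_pairMatrix_add_box i a j b ν (le_max_left s n), box_of_neg (by omega),
    box_of_neg (by omega), add_zero, add_zero]

theorem hasDefect_of_relPos_eq {V W : Flag F n d} (hia : i ≤ a) (hjb : j ≤ b)
    (h : relPos V W = pairMatrix i a j b ν) :
    HasDefect V.chain W.chain fun r s => box i a r s + box j b r s := by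
  have hcorner := (relPos_eq_iff V W _).1 h
  refine ⟨fun s => inf_eq_right.1 (Submodule.eq_of_le_of_finrank_eq inf_le_right ?_),
    fun r s hrs => ?_⟩
  · have hmax := hcorner (max s n) s
    rw [V.chain_of_le (le_max_right s n), top_inf_eq] at hmax
    rw [hmax, cornerSum_pairMatrix_of_le hia hjb ν (le_max_left s n), hcorner]
  · rw [hcorner, cornerSum_pairMatrix_add_box i a j b ν hrs, hasDims_of_relPos_eq h]

theorem relPos_eq_of_hasDefect {V W : Flag F n d} (hia : i ≤ a) (hjb : j ≤ b)
    (hV : HasDims V.chain i j ν)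
    (hd : HasDefect V.chain W.chain fun r s => box i a r s + box j b r s) :
    relPos V W = pairMatrix i a j b ν := by
  have hcorner (r s : ℕ) (hrs : r ≤ s) :
      finrank F ↥(V.chain r ⊓ W.chain s) = cornerSum (pairMatrix i a j b ν) r s := by
    have hrank := hd.finrank_inf r s hrs
    rw [hV, ← cornerSum_pairMatrix_add_box i a j b ν hrs] at hrank
    exact Nat.add_right_cancel hrank
  rw [relPos_eq_iff]
  intro r s
  rcases le_total r s with hrs | hsr
  · exact hcorner r s hrs
  · rw [cornerSum_pairMatrix_of_le hia hjb ν hsr, ← hcorner s s le_rfl, inf_eq_right.2 (hd.le s),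
      inf_eq_right.2 ((hd.le s).trans (V.monotone_chain hsr))]

theorem relPos_eq_step_iff {V W : Flag F n d} (hia : i ≤ a) :
    relPos V W = pairMatrix i a j j ν ↔ HasDims V.chain i j ν ∧ IsStep i a V.chain W.chain := by
  have hiff : HasDefect V.chain W.chain (fun r s => box i a r s + box j j r s) ↔
      HasDefect V.chain W.chain (box i a) := by
    have hbox (r s : ℕ) (hrs : r ≤ s) : box i a r s + box j j r s = box i a r s := by
      rw [box_of_neg (k := j) (by omega), add_zero]
    exact ⟨fun h => ⟨h.le, fun r s hrs => by rw [← hbox r s hrs, h.finrank_inf r s hrs]⟩,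
      fun h => ⟨h.le, fun r s hrs => by rw [hbox r s hrs, h.finrank_inf r s hrs]⟩⟩
  rw [isStep_iff_hasDefect V.monotone_chain W.monotone_chain, ← hiff]
  exact ⟨fun h => ⟨hasDims_of_relPos_eq h, hasDefect_of_relPos_eq hia le_rfl h⟩,
    fun h => relPos_eq_of_hasDefect hia le_rfl h.1 h.2⟩

theorem HasDims.of_isStep {V U : ℕ → Submodule F (Fin d → F)} (hV : HasDims V i j ν)
    (hia : i ≤ a) (h : IsStep i a V U) : HasDims U j a ν := fun s => by
  have hdim := hV s
  rw [Fin.le_def] at hia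
  by_cases hs : (i : ℕ) < s ∧ s ≤ a
  · rw [h.rank s hs.1 hs.2, if_pos hs.1] at hdim
    rw [if_neg (by omega : ¬(a : ℕ) < s)]
    omega
  · rw [← h.eq hs, hdim]
    split_ifs <;> omega

theorem relPos_eq_of_steps {V U W : Flag F n d} (hia : i ≤ a) (hjb : j ≤ b)
    (hVU : relPos V U = pairMatrix i a j j ν) (hUW : relPos U W = pairMatrix j b a a ν) :
    relPos V W = pairMatrix i a j b ν ∨
      (i < j ∧ j ≤ a ∧ a < b) ∧ relPos V W = pairMatrix i b j a ν := by
  obtain ⟨hV, hstepV⟩ := (relPos_eq_step_iff hia).1 hVU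
  obtain ⟨-, hstepU⟩ := (relPos_eq_step_iff hjb).1 hUW
  exact (hstepV.comp hstepU V.monotone_chain U.monotone_chain W.monotone_chain).imp
    (relPos_eq_of_hasDefect hia hjb hV)
    fun ⟨hc, hd⟩ => ⟨hc, relPos_eq_of_hasDefect (hia.trans (Fin.lt_def.2 hc.2.2).le) hc.2.1 hV hd⟩

theorem card_midFlags_eq_ncard_midChains (V W : Flag F n d) (hia : i ≤ a) (hjb : j ≤ b)
    (hV : HasDims V.chain i j ν) :
    Nat.card {U : Flag F n d //
        relPos V U = pairMatrix i a j j ν ∧ relPos U W = pairMatrix j b a a ν} =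
      (midChains i a j b V.chain W.chain).ncard := by
  rw [← Nat.card_coe_set_eq]
  refine Nat.card_eq_of_bijective (fun U => ⟨U.1.chain, U.1.monotone_chain,
    ((relPos_eq_step_iff hia).1 U.2.1).2, ((relPos_eq_step_iff hjb).1 U.2.2).2⟩) ⟨?_, ?_⟩
  · intro U U' h
    exact Subtype.ext (Flag.chain_injective (congrArg Subtype.val h))
  · rintro ⟨U, hU, hVU, hUW⟩
    let U' : Flag F n d := Flag.ofChain U hU (by rw [← hVU.eq (by omega), V.chain_zero])
      (by rw [← hVU.eq (by omega), V.chain_of_le le_rfl])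
    have hU' : U'.chain = U := Flag.chain_ofChain hU _ _
    exact ⟨⟨U', (relPos_eq_step_iff hia).2 ⟨hV, hU'.symm ▸ hVU⟩,
      (relPos_eq_step_iff hjb).2 ⟨hU'.symm ▸ hV.of_isStep hia hVU, hU'.symm ▸ hUW⟩⟩,
      Subtype.ext hU'⟩

theorem card_midFlags_of_split [Finite F] {V W : Flag F n d} (hia : i ≤ a) (hjb : j ≤ b)
    (h : relPos V W = pairMatrix i a j b ν) :
    Nat.card {U : Flag F n d //
        relPos V U = pairMatrix i a j j ν ∧ relPos U W = pairMatrix j b a a ν} =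
      if i = j ∧ a = b ∧ i < a then Nat.card F + 1
      else if i ≤ j ∧ j < a ∧ a ≤ b then Nat.card F else 1 := by
  rw [card_midFlags_eq_ncard_midChains V W hia hjb (hasDims_of_relPos_eq h),
    (hasDefect_of_relPos_eq hia hjb h).ncard_midChains_of_split V.monotone_chain W.monotone_chain]
  simp only [Fin.ext_iff, Fin.lt_def, Fin.le_def]

theorem card_midFlags_of_crossing [Finite F] {V W : Flag F n d} (hia : i ≤ a) (hjb : j ≤ b)
    (hc : i < j ∧ j ≤ a ∧ a < b) (h : relPos V W = pairMatrix i b j a ν) :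
    Nat.card {U : Flag F n d //
        relPos V U = pairMatrix i a j j ν ∧ relPos U W = pairMatrix j b a a ν} =
      if j < a then Nat.card F - 1 else 1 := by
  have hib := hia.trans hc.2.2.le
  rw [card_midFlags_eq_ncard_midChains V W hia hjb (hasDims_of_relPos_eq h),
    (hasDefect_of_relPos_eq hib hc.2.1 h).ncard_midChains_of_crossing hc V.monotone_chain
      W.monotone_chain]
  simp only [Fin.lt_def]

end StepsOfFlags

/-! ### The structure constants of the Schur algebra -/

section CoordinateFlags

variable (F : Type) [Field F] {n d : ℕ}

/-- The subspace of `F ^ d` spanned by the standard basis vectors with index in `S`. Flags of such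
subspaces realize every relative position. -/
def coordSpan (S : Set (Fin d)) : Submodule F (Fin d → F) :=
  Submodule.span F (Pi.basisFun F (Fin d) '' S)

theorem coordSpan_inf (S T : Set (Fin d)) :
    coordSpan F S ⊓ coordSpan F T = coordSpan F (S ∩ T) := by
  ext x
  simp only [coordSpan, Submodule.mem_inf, Basis.mem_span_image, Set.subset_inter_iff]

theorem finrank_coordSpan (S : Set (Fin d)) : finrank F (coordSpan F S) = Nat.card S := by
  classical
  have hind : LinearIndependent F fun t : S => Pi.basisFun F (Fin d) t :=
    (Pi.basisFun F (Fin d)).linearIndependent.comp _ Subtype.val_injective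
  rw [coordSpan, Set.image_eq_range, finrank_span_eq_card hind, Nat.card_eq_fintype_card]

/-- The flag whose step `s` is spanned by the standard basis vectors `e_t` with `w t < s`. -/
def coordFlag (w : Fin d → Fin n) : Flag F n d where
  space s := coordSpan F {t | (w t : ℕ) < s}
  le_succ i := Submodule.span_mono (Set.image_mono fun t ht =>
    lt_trans (b := (i : ℕ)) ht (Nat.lt_succ_self _))
  space_zero := by simp [coordSpan]
  space_last := by
    have huniv : {t : Fin d | (w t : ℕ) < (Fin.last n : Fin (n + 1))} = Set.univ :=
      Set.eq_univ_of_forall fun t => (w t).2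
    rw [huniv, coordSpan, Set.image_univ, Basis.span_eq]

theorem coordFlag_chain (w : Fin d → Fin n) (s : ℕ) :
    (coordFlag F w).chain s = coordSpan F {t | (w t : ℕ) < s} := by
  change coordSpan F {t | (w t : ℕ) < min s n} = _
  simp only [lt_min_iff, Fin.is_lt, and_true]

theorem exists_relPos_eq (C : Theta n d) : ∃ V W : Flag F n d, relPos V W = C.1 := by
  have hcard : Fintype.card (Σ p : Fin n × Fin n, Fin (C.1 p.1 p.2)) = Fintype.card (Fin d) := by
    rw [Fintype.card_sigma, Fintype.card_fin, Fintype.sum_prod_type]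
    simpa using C.2
  let e := Fintype.equivOfCardEq hcard
  refine ⟨coordFlag F fun t => (e.symm t).1.1, coordFlag F fun t => (e.symm t).1.2, ?_⟩
  rw [relPos_eq_iff]
  intro r s
  rw [coordFlag_chain, coordFlag_chain, coordSpan_inf, finrank_coordSpan]
  have hcongr :
      Nat.card ({t | ((e.symm t).1.1 : ℕ) < r} ∩ {t | ((e.symm t).1.2 : ℕ) < s} : Set (Fin d)) =
      Nat.card {x : Σ p : Fin n × Fin n, Fin (C.1 p.1 p.2) // (x.1.1 : ℕ) < r ∧ (x.1.2 : ℕ) < s} :=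
    Nat.card_congr (Equiv.subtypeEquiv e.symm fun t => Iff.rfl)
  rw [hcongr, Nat.card_eq_fintype_card, Fintype.card_subtype, Finset.card_filter,
    Fintype.sum_sigma, Fintype.sum_prod_type]
  refine Finset.sum_congr rfl fun k _ => Finset.sum_congr rfl fun l _ => ?_
  split_ifs <;> simp

end CoordinateFlags

section CountingPolynomials

variable {n d : ℕ} {A B C : Theta n d}

theorem IsCountingPolynomial.unique {P Q : ℤ[X]} (hP : IsCountingPolynomial A B C P)
    (hQ : IsCountingPolynomial A B C Q) : P = Q := by
  refine Polynomial.eq_of_infinite_eval_eq P Q ?_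
  have hinf : {p : ℕ | p.Prime ∧ 2 < p}.Infinite := by
    refine Set.infinite_of_forall_exists_gt fun m => ?_
    obtain ⟨p, hmp, hp⟩ := Nat.exists_infinite_primes (m + 3)
    exact ⟨p, ⟨hp, by omega⟩, by omega⟩
  refine (hinf.image (f := fun p : ℕ => (p : ℤ)) Nat.cast_injective.injOn).mono ?_
  rintro _ ⟨p, ⟨hp, htwo⟩, rfl⟩
  have : Fact p.Prime := ⟨hp⟩
  obtain ⟨V, W, hVW⟩ := exists_relPos_eq (ZMod p) C
  have hchar : ringChar (ZMod p) ≠ 2 := by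
    rw [ZMod.ringChar_zmod_n]
    exact htwo.ne'
  have hcount := (hP (ZMod p) hchar V W hVW).symm.trans (hQ (ZMod p) hchar V W hVW)
  rwa [ZMod.card] at hcount

theorem IsCountingPolynomial.countingPolynomial_eq {P : ℤ[X]} (hP : IsCountingPolynomial A B C P) :
    countingPolynomial A B C = P := by
  have hex : ∃ P, IsCountingPolynomial A B C P := ⟨P, hP⟩
  rw [countingPolynomial, dif_pos hex]
  exact hex.choose_spec.unique hP

variable {i a j b : Fin n}

theorem pairMatrix_ne_pairMatrix {R : Type*} [AddMonoidWithOne R] [IsRightCancelAdd R]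
    [NeZero (1 : R)] (hij : i ≠ j) (hab : a ≠ b) (ν : Fin n → R) :
    pairMatrix i a j b ν ≠ pairMatrix i b j a ν := by
  intro h
  have happly := add_right_cancel (congrFun (congrFun h i) a)
  simp [hij.symm, hab.symm] at happly

/-- The coefficient of the basis element of the split extension in a product of two steps. -/
def splitPoly (i a j b : Fin n) : ℤ[X] :=
  if i = j ∧ a = b ∧ i < a then Polynomial.X + 1
  else if i ≤ j ∧ j < a ∧ a ≤ b then Polynomial.X else 1

/-- The coefficient of the basis element of the nonsplit extension in a product of two steps. -/
def nonsplitPoly (i a j b : Fin n) : ℤ[X] :=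
  if i < j ∧ j ≤ a ∧ a < b then if j < a then Polynomial.X - 1 else 1 else 0

open Classical in
/-- The coefficient of `e_C` in a product of two steps. -/
def stepPoly (i a j b : Fin n) (ν : Fin n → ℕ) (C : Matrix (Fin n) (Fin n) ℕ) : ℤ[X] :=
  (if C = pairMatrix i a j b ν then splitPoly i a j b else 0) +
    if C = pairMatrix i b j a ν then nonsplitPoly i a j b else 0

variable {ν : Fin n → ℕ}

theorem isCountingPolynomial_stepPoly (hia : i ≤ a) (hjb : j ≤ b)
    (hA : A.1 = pairMatrix i a j j ν) (hB : B.1 = pairMatrix j b a a ν) :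
    IsCountingPolynomial A B C (stepPoly i a j b ν C.1) := by
  intro F _ _ _ V W hVW
  have hcard : 1 ≤ Fintype.card F := Fintype.card_pos
  rw [hA, hB, ← hVW, stepPoly]
  by_cases hsplit : relPos V W = pairMatrix i a j b ν
  · rw [card_midFlags_of_split hia hjb hsplit, hsplit, if_pos rfl, splitPoly, nonsplitPoly]
    by_cases hc : i < j ∧ j ≤ a ∧ a < b
    · rw [if_neg (pairMatrix_ne_pairMatrix hc.1.ne hc.2.2.ne ν)]
      split_ifs <;> simp
    · rw [if_neg hc]
      split_ifs <;> simp
  rw [if_neg hsplit, zero_add]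
  by_cases hcross : (i < j ∧ j ≤ a ∧ a < b) ∧ relPos V W = pairMatrix i b j a ν
  · rw [card_midFlags_of_crossing hia hjb hcross.1 hcross.2, if_pos hcross.2, nonsplitPoly,
      if_pos hcross.1, Nat.card_eq_fintype_card]
    split_ifs <;> simp [Nat.cast_sub hcard]
  · have hempty : IsEmpty {U : Flag F n d //
        relPos V U = pairMatrix i a j j ν ∧ relPos U W = pairMatrix j b a a ν} :=
      ⟨fun U => (relPos_eq_of_steps hia hjb U.2.1 U.2.2).elim hsplit hcross⟩
    rw [Nat.card_of_isEmpty, nonsplitPoly]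
    split_ifs with hC hc <;> simp_all

theorem existsUnique_isCountingPolynomial (hia : i ≤ a) (hjb : j ≤ b)
    (hA : A.1 = pairMatrix i a j j ν) (hB : B.1 = pairMatrix j b a a ν) :
    ∃! P, IsCountingPolynomial A B C P :=
  ⟨_, isCountingPolynomial_stepPoly hia hjb hA hB,
    fun _ hP => hP.unique (isCountingPolynomial_stepPoly hia hjb hA hB)⟩

end CountingPolynomials

/-! ### The exponents `d(A) - r(A)` -/

section Exponents

variable {n : ℕ}

/-- The bilinear form whose quadratic form is `d(A) - r(A)`. -/
def crossForm (X Y : Matrix (Fin n) (Fin n) ℕ) : ℤ :=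
  ∑ i, ∑ j, ∑ k, ∑ l, if k ≤ i ∧ j < l then (X i j : ℤ) * (Y k l : ℤ) else 0

theorem orbitDim_diagonal (ρ : Fin n → ℕ) :
    orbitDim (Matrix.diagonal ρ) = ∑ i, ∑ k, if i < k then (ρ i : ℤ) * (ρ k : ℤ) else 0 := by
  refine (sum_sum_diagonal (fun (i j : Fin n) (x : ℕ) => ∑ k, ∑ l,
    if i < k ∨ j < l then (x : ℤ) * ((Matrix.diagonal ρ k l : ℕ) : ℤ) else 0) (by simp) ρ).trans
      (Finset.sum_congr rfl fun i _ => ?_)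
  rw [sum_sum_diagonal (fun (k l : Fin n) (x : ℕ) =>
    if i < k ∨ i < l then (ρ i : ℤ) * (x : ℤ) else 0) (by simp)]
  simp only [or_self]

theorem orbitRowDim_eq (C : Matrix (Fin n) (Fin n) ℕ) :
    orbitRowDim C = ∑ i, ∑ j, ∑ k, ∑ l, if i < k then (C i j : ℤ) * (C k l : ℤ) else 0 := by
  rw [orbitRowDim, orbitDim_diagonal]
  refine Finset.sum_congr rfl fun i _ => ?_
  rw [Finset.sum_comm]
  refine Finset.sum_congr rfl fun k _ => ?_
  split_ifs <;> simp [Finset.sum_mul_sum]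

theorem orbitDim_sub_orbitRowDim (C : Matrix (Fin n) (Fin n) ℕ) :
    orbitDim C - orbitRowDim C = crossForm C C := by
  rw [orbitRowDim_eq, orbitDim, crossForm]
  simp only [← Finset.sum_sub_distrib]
  refine Finset.sum_congr rfl fun i _ => Finset.sum_congr rfl fun j _ =>
    Finset.sum_congr rfl fun k _ => Finset.sum_congr rfl fun l _ => ?_
  by_cases hik : i < k
  · simp [hik, hik.not_ge]
  · simp [hik, not_lt.1 hik]

theorem crossForm_add_left (X X' Y : Matrix (Fin n) (Fin n) ℕ) :
    crossForm (X + X') Y = crossForm X Y + crossForm X' Y := by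
  simp only [crossForm, Matrix.add_apply, Nat.cast_add, add_mul, ite_add_zero,
    Finset.sum_add_distrib]

theorem crossForm_add_right (X Y Y' : Matrix (Fin n) (Fin n) ℕ) :
    crossForm X (Y + Y') = crossForm X Y + crossForm X Y' := by
  simp only [crossForm, Matrix.add_apply, Nat.cast_add, mul_add, ite_add_zero,
    Finset.sum_add_distrib]

theorem crossForm_single_left (i a : Fin n) (Y : Matrix (Fin n) (Fin n) ℕ) :
    crossForm (Matrix.single i a 1) Y = ∑ k, ∑ l, if k ≤ i ∧ a < l then (Y k l : ℤ) else 0 := by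
  rw [crossForm, sum_sum_single (fun (i j : Fin n) (x : ℕ) => ∑ k, ∑ l,
    if k ≤ i ∧ j < l then (x : ℤ) * (Y k l : ℤ) else 0) (by simp)]
  simp only [Nat.cast_one, one_mul]

theorem crossForm_diagonal_left (ν : Fin n → ℕ) (Y : Matrix (Fin n) (Fin n) ℕ) :
    crossForm (Matrix.diagonal ν) Y =
      ∑ i, ∑ k, ∑ l, if k ≤ i ∧ i < l then (ν i : ℤ) * (Y k l : ℤ) else 0 :=
  sum_sum_diagonal (fun (i j : Fin n) (x : ℕ) => ∑ k, ∑ l,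
    if k ≤ i ∧ j < l then (x : ℤ) * (Y k l : ℤ) else 0) (by simp) ν

theorem crossForm_single_single (i a j b : Fin n) :
    crossForm (Matrix.single i a 1) (Matrix.single j b 1) = if j ≤ i ∧ a < b then 1 else 0 := by
  rw [crossForm_single_left, sum_sum_single (fun (k l : Fin n) (x : ℕ) =>
    if k ≤ i ∧ a < l then (x : ℤ) else 0) (by simp), Nat.cast_one]

theorem crossForm_single_diagonal {i a : Fin n} (hia : i ≤ a) (ν : Fin n → ℕ) :
    crossForm (Matrix.single i a 1) (Matrix.diagonal ν) = 0 := by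
  rw [crossForm_single_left, sum_sum_diagonal (fun (k l : Fin n) (x : ℕ) =>
    if k ≤ i ∧ a < l then (x : ℤ) else 0) (by simp)]
  exact Finset.sum_eq_zero fun k _ => if_neg fun hk => (hk.1.trans hia).not_gt hk.2

/-- The sum of the entries `ν k` with `i ≤ k < a`. -/
def intervalSum (i a : Fin n) (ν : Fin n → ℕ) : ℤ :=
  ∑ k, if i ≤ k ∧ k < a then (ν k : ℤ) else 0

theorem crossForm_diagonal_single (i a : Fin n) (ν : Fin n → ℕ) :
    crossForm (Matrix.diagonal ν) (Matrix.single i a 1) = intervalSum i a ν := by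
  rw [crossForm_diagonal_left]
  refine Finset.sum_congr rfl fun m _ => ?_
  rw [sum_sum_single (fun (k l : Fin n) (x : ℕ) =>
    if k ≤ m ∧ m < l then (ν m : ℤ) * (x : ℤ) else 0) (by simp), Nat.cast_one, mul_one]

theorem crossForm_diagonal_diagonal (μ ν : Fin n → ℕ) :
    crossForm (Matrix.diagonal μ) (Matrix.diagonal ν) = 0 := by
  rw [crossForm_diagonal_left]
  refine Finset.sum_eq_zero fun i _ => ?_
  rw [sum_sum_diagonal (fun (k l : Fin n) (x : ℕ) =>
    if k ≤ i ∧ i < l then (μ i : ℤ) * (x : ℤ) else 0) (by simp)]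
  exact Finset.sum_eq_zero fun k _ => if_neg fun hk => hk.1.not_gt hk.2

variable {i a j b : Fin n}

theorem orbitDim_sub_orbitRowDim_pairMatrix (hia : i ≤ a) (hjb : j ≤ b) (ν : Fin n → ℕ) :
    orbitDim (pairMatrix i a j b ν) - orbitRowDim (pairMatrix i a j b ν) =
      intervalSum i a ν + intervalSum j b ν + (if j ≤ i ∧ a < b then 1 else 0) +
        if i ≤ j ∧ b < a then 1 else 0 := by
  rw [orbitDim_sub_orbitRowDim]
  simp only [pairMatrix, crossForm_add_left, crossForm_add_right, crossForm_single_single,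
    crossForm_single_diagonal hia, crossForm_single_diagonal hjb, crossForm_diagonal_single,
    crossForm_diagonal_diagonal, lt_irrefl, and_false, if_false]
  ring

theorem orbitDim_sub_orbitRowDim_step (hia : i ≤ a) (j : Fin n) (ν : Fin n → ℕ) :
    orbitDim (pairMatrix i a j j ν) - orbitRowDim (pairMatrix i a j j ν) =
      intervalSum i a ν + if i ≤ j ∧ j < a then 1 else 0 := by
  have hself : intervalSum j j ν = 0 :=
    Finset.sum_eq_zero fun k _ => if_neg fun hk => hk.1.not_gt hk.2
  rw [orbitDim_sub_orbitRowDim_pairMatrix hia le_rfl, hself,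
    if_neg fun h => (h.1.trans hia).not_gt h.2]
  ring

theorem intervalSum_add_intervalSum (hij : i ≤ j) (hja : j ≤ a) (hab : a ≤ b) (ν : Fin n → ℕ) :
    intervalSum i b ν + intervalSum j a ν = intervalSum i a ν + intervalSum j b ν := by
  simp only [intervalSum, ← Finset.sum_add_distrib]
  refine Finset.sum_congr rfl fun k _ => ?_
  simp only [Fin.le_def, Fin.lt_def] at *
  split_ifs <;> omega

end Exponents

/-! ### The stabilized product -/

section SchurProducts

variable {n d : ℕ} {i a j b : Fin n}

theorem v_ne_zero : v ≠ 0 := RatFunc.X_ne_zero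

theorem map_natCast_injective :
    Function.Injective fun M : Matrix (Fin n) (Fin n) ℕ => M.map ((↑) : ℕ → ℤ) :=
  Matrix.map_injective Nat.cast_injective

theorem bracket_map_natCast_apply (M : Matrix (Fin n) (Fin n) ℕ) (C : Theta n d) :
    bracket d (M.map ((↑) : ℕ → ℤ)) C =
      if C.1 = M then v ^ (-(orbitDim M - orbitRowDim M)) else 0 := by
  rw [bracket, if_congr map_natCast_injective.eq_iff rfl rfl]
  split_ifs with h
  · rw [h]
  · rfl

theorem bracket_map_natCast (A : Theta n d) :
    bracket d (A.1.map ((↑) : ℕ → ℤ)) = Pi.single A (v ^ (-(orbitDim A.1 - orbitRowDim A.1))) := by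
  funext C
  simp only [bracket_map_natCast_apply, Pi.single_apply, Subtype.ext_iff]

theorem bracket_eq_zero {M : Matrix (Fin n) (Fin n) ℕ} (h : ∑ i, ∑ j, M i j ≠ d) :
    bracket d (M.map ((↑) : ℕ → ℤ)) = 0 := by
  funext C
  rw [bracket_map_natCast_apply, if_neg, Pi.zero_apply]
  rintro rfl
  exact h C.2

theorem schurMul_single_single (A B C : Theta n d) (x y : Qv) :
    schurMul (Pi.single A x) (Pi.single B y) C =
      x * y * Polynomial.aeval (v ^ 2) (countingPolynomial A B C) := by
  simp [schurMul, Pi.single_apply]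

theorem schurMul_zero_left (g : Schur n d) : schurMul 0 g = 0 := by
  funext C
  simp [schurMul]

/-- The coefficient of the split extension in the stabilized product of two steps. -/
def splitCoeff (i a j b : Fin n) : Qv :=
  v ^ (-((if i < j ∧ j ≤ a ∧ a < b then 1 else 0) + if i ≤ j ∧ j < a ∧ a ≤ b then 1 else 0) : ℤ) *
    Polynomial.aeval (v ^ 2) (splitPoly i a j b)

/-- The coefficient of the nonsplit extension in the stabilized product of two steps. -/
def nonsplitCoeff (i a j b : Fin n) : Qv :=
  v ^ (-(if j < a then 1 else 0) : ℤ) * Polynomial.aeval (v ^ 2) (nonsplitPoly i a j b)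

theorem orbitDim_step_add_orbitDim_step_of_split (hia : i ≤ a) (hjb : j ≤ b) (μ : Fin n → ℕ) :
    orbitDim (pairMatrix i a j j μ) - orbitRowDim (pairMatrix i a j j μ) +
        (orbitDim (pairMatrix j b a a μ) - orbitRowDim (pairMatrix j b a a μ)) =
      orbitDim (pairMatrix i a j b μ) - orbitRowDim (pairMatrix i a j b μ) +
        ((if i < j ∧ j ≤ a ∧ a < b then 1 else 0) + if i ≤ j ∧ j < a ∧ a ≤ b then 1 else 0) := by
  rw [orbitDim_sub_orbitRowDim_step hia, orbitDim_sub_orbitRowDim_step hjb,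
    orbitDim_sub_orbitRowDim_pairMatrix hia hjb]
  simp only [Fin.le_def, Fin.lt_def] at hia hjb ⊢
  split_ifs <;> omega

theorem orbitDim_step_add_orbitDim_step_of_crossing (hc : i < j ∧ j ≤ a ∧ a < b) (μ : Fin n → ℕ) :
    orbitDim (pairMatrix i a j j μ) - orbitRowDim (pairMatrix i a j j μ) +
        (orbitDim (pairMatrix j b a a μ) - orbitRowDim (pairMatrix j b a a μ)) =
      orbitDim (pairMatrix i b j a μ) - orbitRowDim (pairMatrix i b j a μ) +
        if j < a then 1 else 0 := by
  obtain ⟨hij, hja, hab⟩ := hc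
  have hinterval := intervalSum_add_intervalSum hij.le hja hab.le μ
  rw [orbitDim_sub_orbitRowDim_step (hij.le.trans hja),
    orbitDim_sub_orbitRowDim_step (hja.trans hab.le),
    orbitDim_sub_orbitRowDim_pairMatrix (hij.le.trans (hja.trans hab.le)) hja]
  simp only [Fin.le_def, Fin.lt_def] at hij hja hab ⊢
  split_ifs <;> omega

theorem sum_pairMatrix (i a j b : Fin n) (μ : Fin n → ℕ) :
    ∑ k, ∑ l, pairMatrix i a j b μ k l = 2 + ∑ k, μ k := by
  simp [pairMatrix, Finset.sum_add_distrib, Matrix.single_apply, Matrix.diagonal_apply, ite_and]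

theorem zpow_neg_add_mul_aeval_ite (p : Prop) [Decidable p] (P : ℤ[X]) (x y : ℤ) :
    v ^ (-(x + y)) * Polynomial.aeval (v ^ 2) (if p then P else 0) =
      v ^ (-y) * Polynomial.aeval (v ^ 2) P * if p then v ^ (-x) else 0 := by
  rw [neg_add, zpow_add₀ v_ne_zero]
  split_ifs
  · ring
  · rw [map_zero, mul_zero, mul_zero]

theorem schurMul_bracket_step (hia : i ≤ a) (hjb : j ≤ b) (μ : Fin n → ℕ) :
    schurMul (bracket d ((pairMatrix i a j j μ).map ((↑) : ℕ → ℤ)))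
        (bracket d ((pairMatrix j b a a μ).map ((↑) : ℕ → ℤ))) =
      splitCoeff i a j b • bracket d ((pairMatrix i a j b μ).map ((↑) : ℕ → ℤ)) +
        nonsplitCoeff i a j b • bracket d ((pairMatrix i b j a μ).map ((↑) : ℕ → ℤ)) := by
  by_cases hd : 2 + ∑ k, μ k = d
  swap
  · simp only [bracket_eq_zero ((sum_pairMatrix _ _ _ _ μ).trans_ne hd), schurMul_zero_left,
      smul_zero, add_zero]
  let A : Theta n d := ⟨pairMatrix i a j j μ, (sum_pairMatrix _ _ _ _ μ).trans hd⟩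
  let B : Theta n d := ⟨pairMatrix j b a a μ, (sum_pairMatrix _ _ _ _ μ).trans hd⟩
  funext C
  have hpoly := (isCountingPolynomial_stepPoly (A := A) (B := B) (C := C) hia hjb rfl
    rfl).countingPolynomial_eq
  rw [bracket_map_natCast A, bracket_map_natCast B, schurMul_single_single, hpoly,
    ← zpow_add₀ v_ne_zero, ← neg_add, stepPoly, map_add, mul_add, Pi.add_apply, Pi.smul_apply,
    Pi.smul_apply, bracket_map_natCast_apply, bracket_map_natCast_apply, smul_eq_mul, smul_eq_mul]
  congr 1
  · rw [orbitDim_step_add_orbitDim_step_of_split hia hjb, zpow_neg_add_mul_aeval_ite, splitCoeff]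
  · by_cases hc : i < j ∧ j ≤ a ∧ a < b
    · rw [orbitDim_step_add_orbitDim_step_of_crossing hc, zpow_neg_add_mul_aeval_ite, nonsplitCoeff]
    · simp only [nonsplitCoeff, nonsplitPoly, if_neg hc, ite_self, map_zero, mul_zero, zero_mul]

end SchurProducts

section Stabilization

variable {n : ℕ} {i a j b : Fin n}

theorem injective_v_zpow_neg : Function.Injective fun p : ℕ => v ^ (-(p : ℤ)) := by
  intro p q hpq
  have hmap (m : ℕ) : v ^ m = algebraMap ℚ[X] Qv (Polynomial.X ^ m) := by
    rw [map_pow, RatFunc.algebraMap_X, v]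
  simp only [zpow_neg, zpow_natCast, inv_inj, hmap] at hpq
  simpa using congrArg Polynomial.natDegree (RatFunc.algebraMap_injective ℚ hpq)

theorem shift_apply (p : ℕ) (Z : ThetaTilde n) (i j : Fin n) :
    shift p Z i j = Z.1 i j + if i = j then (p : ℤ) else 0 := by
  rw [shift, Matrix.add_apply, Matrix.smul_apply, Matrix.one_apply]
  split_ifs <;> simp

theorem shift_injective (p : ℕ) : Function.Injective (shift p : ThetaTilde n → _) :=
  fun _ _ h => Subtype.ext (add_right_cancel h)

theorem exists_theta_eq_shift {Z : ThetaTilde n} {p : ℕ} (hp : ∀ i, 0 ≤ Z.1 i i + p) :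
    ∃ (d : ℕ) (C : Theta n d), C.1.map ((↑) : ℕ → ℤ) = shift p Z := by
  let M : Matrix (Fin n) (Fin n) ℕ := Matrix.of fun i j => (shift p Z i j).toNat
  refine ⟨∑ i, ∑ j, M i j, ⟨M, rfl⟩, ?_⟩
  ext i j
  have hnonneg : 0 ≤ shift p Z i j := by
    rw [shift_apply]
    rcases eq_or_ne i j with rfl | hij
    · simpa using hp i
    · simpa [hij] using Z.2 i j hij
  simpa [M] using hnonneg

theorem exists_forall_nonneg_add (f : Fin n → ℤ) :
    ∃ p₀ : ℕ, ∀ p : ℕ, p₀ ≤ p → ∀ i, 0 ≤ f i + (p : ℤ) := by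
  refine ⟨∑ i, (f i).natAbs, fun p hp i => ?_⟩
  have hle := Finset.single_le_sum (f := fun i => (f i).natAbs) (fun _ _ => Nat.zero_le _)
    (Finset.mem_univ i)
  omega

theorem sum_smul_bracket_apply (G : ThetaTilde n →₀ Qv[X]) (Z : ThetaTilde n) (x : Qv) (p : ℕ)
    {d : ℕ} {C : Theta n d} (hC : C.1.map ((↑) : ℕ → ℤ) = shift p Z) :
    (G.sum fun Z g => g.eval x • bracket d (shift p Z)) C =
      (G Z).eval x * v ^ (-(orbitDim C.1 - orbitRowDim C.1)) := by
  rw [Finsupp.sum, Finset.sum_apply, Finset.sum_eq_single Z]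
  · simp [bracket, hC]
  · intro Z' _ hZ'
    simp [bracket, hC, (shift_injective p).ne hZ'.symm]
  · intro hZ
    simp [Finsupp.notMem_support_iff.1 hZ]

theorem IsStabilization.unique {A B : ThetaTilde n} {G G' : ThetaTilde n →₀ Qv[X]}
    (hG : IsStabilization A B G) (hG' : IsStabilization A B G') : G = G' := by
  obtain ⟨p₁, hp₁⟩ := hG.2
  obtain ⟨p₂, hp₂⟩ := hG'.2
  ext1 Z
  obtain ⟨p₃, hp₃⟩ := exists_forall_nonneg_add fun i => Z.1 i i
  refine Polynomial.eq_of_infinite_eval_eq _ _ ?_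
  refine ((Set.Ici_infinite (max p₁ (max p₂ p₃))).image
    (f := fun p : ℕ => v ^ (-(p : ℤ))) injective_v_zpow_neg.injOn).mono ?_
  rintro _ ⟨p, hp, rfl⟩
  simp only [Set.mem_Ici, max_le_iff] at hp
  obtain ⟨d, C, hC⟩ := exists_theta_eq_shift (hp₃ p hp.2.2)
  have hsum := congrFun ((hp₁ p hp.1 d).symm.trans (hp₂ p hp.2.1 d)) C
  rw [sum_smul_bracket_apply _ Z _ p hC, sum_smul_bracket_apply _ Z _ p hC] at hsum
  exact mul_right_cancel₀ (zpow_ne_zero _ v_ne_zero) hsum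

/-- The matrix `E_{ia} + E_{jb} + diag ν` as an element of `Θ̃`. -/
def pairTilde (i a j b : Fin n) (ν : Fin n → ℤ) : ThetaTilde n :=
  ⟨pairMatrix i a j b ν, fun k l hkl => by
    rw [pairMatrix, Matrix.add_apply, Matrix.add_apply, Matrix.diagonal_apply_ne _ hkl, add_zero,
      Matrix.single_apply, Matrix.single_apply]
    split_ifs <;> norm_num⟩

theorem ro_pairTilde (i a j b : Fin n) (ν : Fin n → ℤ) :
    ro (pairTilde i a j b ν) = Pi.single i 1 + Pi.single j 1 + ν := by
  funext k
  simp [ro, pairTilde, pairMatrix, Finset.sum_add_distrib, Matrix.single_apply,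
    Matrix.diagonal_apply, Pi.single_apply, ite_and, eq_comm]

theorem co_pairTilde (i a j b : Fin n) (ν : Fin n → ℤ) :
    co (pairTilde i a j b ν) = Pi.single a 1 + Pi.single b 1 + ν := by
  funext k
  simp [co, pairTilde, pairMatrix, Finset.sum_add_distrib, Matrix.single_apply,
    Matrix.diagonal_apply, Pi.single_apply, ite_and, eq_comm]

theorem pairTilde_comm (i a j b : Fin n) (ν : Fin n → ℤ) :
    pairTilde i a j b ν = pairTilde j b i a ν :=
  Subtype.ext (congrArg (· + Matrix.diagonal ν) (add_comm _ _))

theorem shift_pairTilde (i a j b : Fin n) {ν : Fin n → ℤ} {p : ℕ} (hp : ∀ k, 0 ≤ ν k + (p : ℤ)) :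
    shift p (pairTilde i a j b ν) =
      (pairMatrix i a j b fun k => (ν k + p).toNat).map ((↑) : ℕ → ℤ) := by
  ext k l
  rcases eq_or_ne k l with rfl | hkl
  · simp [shift_apply, pairTilde, pairMatrix, Matrix.single_apply, hp k, add_assoc]
  · simp [shift_apply, pairTilde, pairMatrix, Matrix.single_apply, hkl]

/-- The stabilizing family for a product of two steps; it does not depend on `v'`. -/
def stepFamily (i a j b : Fin n) (ν : Fin n → ℤ) : ThetaTilde n →₀ Qv[X] :=
  Finsupp.single (pairTilde i a j b ν) (Polynomial.C (splitCoeff i a j b)) +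
    Finsupp.single (pairTilde i b j a ν) (Polynomial.C (nonsplitCoeff i a j b))

theorem stepFamily_sum (i a j b : Fin n) (ν : Fin n → ℤ) (d p : ℕ) (x : Qv) :
    ((stepFamily i a j b ν).sum fun Z g => g.eval x • bracket d (shift p Z)) =
      splitCoeff i a j b • bracket d (shift p (pairTilde i a j b ν)) +
        nonsplitCoeff i a j b • bracket d (shift p (pairTilde i b j a ν)) := by
  rw [stepFamily, Finsupp.sum_add_index' (by simp) fun Z g g' => by
    rw [Polynomial.eval_add, add_smul]]
  simp

theorem eq_of_mem_support_stepFamily {ν : Fin n → ℤ} {Z : ThetaTilde n}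
    (hZ : Z ∈ (stepFamily i a j b ν).support) :
    Z = pairTilde i a j b ν ∨ Z = pairTilde i b j a ν := by
  classical
  exact (Finset.mem_union.1 (Finsupp.support_add hZ)).imp
    (fun h => Finset.mem_singleton.1 (Finsupp.support_single_subset h))
    fun h => Finset.mem_singleton.1 (Finsupp.support_single_subset h)

theorem isStabilization_stepFamily (hia : i ≤ a) (hjb : j ≤ b) (ν : Fin n → ℤ) :
    IsStabilization (pairTilde i a j j ν) (pairTilde j b a a ν) (stepFamily i a j b ν) := by
  refine ⟨fun Z hZ => ?_, ?_⟩
  · simp only [ro_pairTilde, co_pairTilde]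
    rcases eq_of_mem_support_stepFamily hZ with rfl | rfl
    · rw [ro_pairTilde, co_pairTilde, add_comm (Pi.single a 1)]
      exact ⟨rfl, rfl⟩
    · rw [ro_pairTilde, co_pairTilde]
      exact ⟨rfl, rfl⟩
  · obtain ⟨p₀, hp₀⟩ := exists_forall_nonneg_add ν
    refine ⟨p₀, fun p hp d => ?_⟩
    rw [stepFamily_sum]
    simp only [shift_pairTilde _ _ _ _ (hp₀ p hp)]
    exact schurMul_bracket_step hia hjb _

theorem stableProductDefined_pairTilde (hia : i ≤ a) (hjb : j ≤ b) (ν : Fin n → ℤ) :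
    StableProductDefined (pairTilde i a j j ν) (pairTilde j b a a ν) := by
  refine ⟨?_, _, isStabilization_stepFamily hia hjb ν,
    fun _ hG => hG.unique (isStabilization_stepFamily hia hjb ν)⟩
  obtain ⟨p₀, hp₀⟩ := exists_forall_nonneg_add ν
  refine ⟨p₀, fun p hp d A' B' C hA hB => ?_⟩
  rw [shift_pairTilde _ _ _ _ (hp₀ p hp)] at hA hB
  exact existsUnique_isCountingPolynomial hia hjb (map_natCast_injective hA)
    (map_natCast_injective hB)

theorem kMul_pairTilde (hia : i ≤ a) (hjb : j ≤ b) (ν : Fin n → ℤ) :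
    kMul (pairTilde i a j j ν) (pairTilde j b a a ν) =
      Finsupp.single (pairTilde i a j b ν) (splitCoeff i a j b) +
        Finsupp.single (pairTilde i b j a ν) (nonsplitCoeff i a j b) := by
  have hstab := isStabilization_stepFamily hia hjb ν
  have hdefined : co (pairTilde i a j j ν) = ro (pairTilde j b a a ν) ∧
      ∃ G, IsStabilization (pairTilde i a j j ν) (pairTilde j b a a ν) G :=
    ⟨by rw [co_pairTilde, ro_pairTilde, add_comm (Pi.single a 1)], _, hstab⟩
  rw [kMul, dif_pos hdefined, hdefined.2.choose_spec.unique hstab, stepFamily,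
    Finsupp.mapRange_add fun _ _ => Polynomial.eval_add, Finsupp.mapRange_single,
    Finsupp.mapRange_single, Polynomial.eval_C, Polynomial.eval_C]

end Stabilization

/-! ### Products of the generators -/

section Generators

variable {n : ℕ} {i a j b : Fin n}

theorem hatElt_apply_addDiag (A : ThetaZero n) (lam : Fin n → ℤ) (i : Fin n) :
    (hatElt A (Pi.single i 1)).1 (addDiag A lam) = v ^ ((addDiag A lam).1 i i) := by
  refine (if_pos ⟨lam, rfl⟩).trans ?_
  simp [Pi.single_apply]

theorem exists_eq_addDiag_of_hatElt_ne_zero {A : ThetaZero n} {j : Fin n → ℤ} {M : ThetaTilde n}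
    (h : (hatElt A j).1 M ≠ 0) : ∃ lam, M = addDiag A lam := by
  by_contra hne
  exact h (if_neg hne)

theorem pairTilde_eq_addDiag_unitMat (hia : i < a) (j : Fin n) (ν : Fin n → ℤ) :
    pairTilde i a j j ν = addDiag (unitMat i a hia) (Pi.single j 1 + ν) := by
  refine Subtype.ext ?_
  change Matrix.single i a 1 + Matrix.single j j 1 + Matrix.diagonal ν =
    Matrix.single i a 1 + Matrix.diagonal (Pi.single j 1 + ν)
  rw [add_assoc, ← Matrix.diagonal_single, Matrix.diagonal_add]
  rfl

theorem pairTilde_eq_addDiag_zeroMat (i j : Fin n) (ν : Fin n → ℤ) :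
    pairTilde i i j j ν = addDiag (zeroMat n) (Pi.single i 1 + Pi.single j 1 + ν) := by
  refine Subtype.ext ?_
  change Matrix.single i i 1 + Matrix.single j j 1 + Matrix.diagonal ν =
    0 + Matrix.diagonal (Pi.single i 1 + Pi.single j 1 + ν)
  rw [zero_add, ← Matrix.diagonal_single, ← Matrix.diagonal_single, Matrix.diagonal_add,
    Matrix.diagonal_add]
  rfl

theorem pairTilde_apply_diag (i a j : Fin n) (ν : Fin n → ℤ) :
    (pairTilde i a j j ν).1 i i = (if i = a then 1 else 0) + (ν i + if i = j then 1 else 0) := by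
  simp only [pairTilde, pairMatrix, Matrix.add_apply, Matrix.single_apply,
    Matrix.diagonal_apply_eq, and_self, true_and, eq_comm (b := i)]
  ring

/-- The coefficient of `t̄_{ia}` at a matrix `E_{ia} + diag μ` with `μ i = 0`. -/
def generatorWeight (i a : Fin n) : Qv := if i < a then v - v⁻¹ else if i = a then v else 0

theorem generatorWeight_eq_zero (h : a < i) : generatorWeight i a = 0 := by
  rw [generatorWeight, if_neg h.not_gt, if_neg h.ne']

theorem tbar_apply_pairTilde (i a j : Fin n) (ν : Fin n → ℤ) :
    (tbar i a).1 (pairTilde i a j j ν) =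
      generatorWeight i a * v ^ (ν i + if i = j then 1 else 0) := by
  have hdiag := pairTilde_apply_diag i a j ν
  rcases lt_trichotomy i a with hia | rfl | hai
  · rw [pairTilde_eq_addDiag_unitMat hia] at hdiag ⊢
    rw [tbar, dif_pos hia, generatorWeight, if_pos hia]
    change -(v⁻¹ - v) * (hatElt _ _).1 _ = _
    rw [hatElt_apply_addDiag, hdiag, if_neg hia.ne, zero_add, neg_sub]
  · rw [pairTilde_eq_addDiag_zeroMat] at hdiag ⊢
    rw [tbar, dif_neg (lt_irrefl i), if_pos rfl, generatorWeight, if_neg (lt_irrefl i), if_pos rfl,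
      hatElt_apply_addDiag, hdiag, if_pos rfl, zpow_add₀ v_ne_zero, zpow_one]
  · rw [tbar, dif_neg hai.not_gt, if_neg hai.ne', generatorWeight, if_neg hai.not_gt,
      if_neg hai.ne', zero_mul]
    rfl

theorem exists_eq_pairTilde_of_tbar_ne_zero {M : ThetaTilde n} (hM : (tbar i a).1 M ≠ 0)
    (j : Fin n) : i ≤ a ∧ ∃ ν, M = pairTilde i a j j ν := by
  unfold tbar at hM
  split_ifs at hM with hlt heq
  · have hhat : (hatElt (unitMat i a hlt) (Pi.single i 1)).1 M ≠ 0 :=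
      right_ne_zero_of_mul (a := -(v⁻¹ - v)) hM
    obtain ⟨lam, rfl⟩ := exists_eq_addDiag_of_hatElt_ne_zero hhat
    refine ⟨hlt.le, lam - Pi.single j 1, ?_⟩
    rw [pairTilde_eq_addDiag_unitMat hlt, add_sub_cancel]
  · subst heq
    obtain ⟨lam, rfl⟩ := exists_eq_addDiag_of_hatElt_ne_zero hM
    refine ⟨le_rfl, lam - (Pi.single i 1 + Pi.single j 1), ?_⟩
    rw [pairTilde_eq_addDiag_zeroMat, add_sub_cancel]
  · exact absurd rfl hM

theorem exists_eq_pairTilde_pair {A B : ThetaTilde n} (hA : (tbar i a).1 A ≠ 0)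
    (hB : (tbar j b).1 B ≠ 0) (hAB : co A = ro B) :
    i ≤ a ∧ j ≤ b ∧ ∃ ν, A = pairTilde i a j j ν ∧ B = pairTilde j b a a ν := by
  obtain ⟨hia, ν, rfl⟩ := exists_eq_pairTilde_of_tbar_ne_zero hA j
  obtain ⟨hjb, μ, rfl⟩ := exists_eq_pairTilde_of_tbar_ne_zero hB a
  rw [co_pairTilde, ro_pairTilde, add_comm (Pi.single a 1)] at hAB
  exact ⟨hia, hjb, ν, rfl, by rw [add_left_cancel hAB]⟩

theorem tbar_mul_tbar_apply_eq_kMul (i a j b : Fin n) {C : ThetaTilde n} {ν : Fin n → ℤ}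
    (hC : ro C = Pi.single i 1 + Pi.single j 1 + ν) :
    (tbar i a * tbar j b).1 C =
      (tbar i a).1 (pairTilde i a j j ν) * (tbar j b).1 (pairTilde j b a a ν) *
        kMul (pairTilde i a j j ν) (pairTilde j b a a ν) C := by
  rw [Khat_mul_apply]
  refine finsum_eq_single _ (pairTilde i a j j ν, pairTilde j b a a ν) fun ⟨A, B⟩ hne => ?_
  by_contra hterm
  obtain ⟨⟨hA, hB⟩, hkMul⟩ := (mul_ne_zero_iff.1 hterm).imp_left mul_ne_zero_iff.1
  obtain ⟨hAB, hro, -⟩ := kMul_ne_zero hkMul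
  obtain ⟨-, -, μ, rfl, rfl⟩ := exists_eq_pairTilde_pair hA hB hAB
  rw [hC, ro_pairTilde] at hro
  exact hne (by rw [add_left_cancel hro])

/-- The coefficient of the normalized split part in `t̄_{ia} t̄_{jb}`. It takes the factor `v` of
`t̄_{kk}` into account and therefore depends only on the order of `i`, `j` and of `a`, `b`, except
for the square of a generator. -/
def splitFactor (i a j b : Fin n) : Qv :=
  if i < j then if a = b then v else 1
  else if j < i then 1
  else if a < b then v ^ 2
  else if b < a then v
  else if i < a then v ^ 2 + 1
  else v ^ 2

theorem zpow_mul_splitCoeff (hia : i ≤ a) (hjb : j ≤ b) :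
    v ^ ((if i = j then 1 else 0) + if j = a then 1 else 0 : ℤ) * splitCoeff i a j b =
      splitFactor i a j b := by
  have haeval : Polynomial.aeval (v ^ 2) (splitPoly i a j b) =
      if i = j ∧ a = b ∧ i < a then v ^ 2 + 1 else if i ≤ j ∧ j < a ∧ a ≤ b then v ^ 2 else 1 := by
    rw [splitPoly]
    split_ifs <;> simp only [map_add, Polynomial.aeval_X, map_one]
  have hv := v_ne_zero
  rw [splitCoeff, splitFactor, haeval, ← mul_assoc, ← zpow_add₀ v_ne_zero]
  simp only [Fin.le_def, Fin.lt_def, Fin.ext_iff] at hia hjb ⊢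
  rcases lt_trichotomy i.1 j with hij | hij | hij <;>
    rcases lt_trichotomy a.1 b with hab | hab | hab <;>
    rcases lt_trichotomy j.1 a with hja | hja | hja <;>
    first
    | omega
    | simp (disch := omega) only [if_pos, if_neg]
      norm_num <;> field_simp

theorem generatorWeight_mul_nonsplitCoeff (i a j b : Fin n) :
    generatorWeight i a * generatorWeight j b *
        (v ^ ((if i = j then 1 else 0) + (if j = a then 1 else 0) : ℤ) * nonsplitCoeff i a j b) =
      if i < j ∧ a < b then (v - v⁻¹) * (generatorWeight i b * generatorWeight j a) else 0 := by
  have hv := v_ne_zero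
  by_cases hijab : i < j ∧ a < b
  swap
  · rw [nonsplitCoeff, nonsplitPoly, if_neg hijab,
      if_neg fun h : i < j ∧ j ≤ a ∧ a < b => hijab ⟨h.1, h.2.2⟩, map_zero, mul_zero,
      mul_zero, mul_zero]
  rw [if_pos hijab]
  obtain ⟨hij, hab⟩ := hijab
  rw [nonsplitCoeff, nonsplitPoly, if_neg hij.ne, zero_add]
  rcases lt_trichotomy j a with hja | rfl | haj
  · simp only [generatorWeight, hij, hab, hja, hja.le, hja.ne, hij.trans hja, hja.trans hab,
      hij.trans (hja.trans hab), and_self, if_true, if_false, map_sub, Polynomial.aeval_X, map_one]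
    field_simp
  · simp only [generatorWeight, hij, hab, hij.trans hab, le_refl, lt_irrefl, and_self, if_true,
      if_false, neg_zero, zpow_zero, zpow_one, map_one, mul_one]
    ring
  · simp only [generatorWeight, haj.not_gt, haj.not_ge, haj.ne', and_false, false_and, if_false,
      map_zero, mul_zero]

open Classical in
theorem generatorWeight_mul_kMul_pairTilde (i a j b : Fin n) (ν : Fin n → ℤ) (C : ThetaTilde n) :
    generatorWeight i a * generatorWeight j b *
        (v ^ ((if i = j then 1 else 0) + if j = a then 1 else 0 : ℤ) *
          kMul (pairTilde i a j j ν) (pairTilde j b a a ν) C) =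
      (if C = pairTilde i a j b ν then
          splitFactor i a j b * (generatorWeight i a * generatorWeight j b) else 0) +
        if C = pairTilde i b j a ν then
          if i < j ∧ a < b then (v - v⁻¹) * (generatorWeight i b * generatorWeight j a) else 0
        else 0 := by
  rw [← generatorWeight_mul_nonsplitCoeff]
  rcases lt_or_ge a i with hai | hia
  · simp only [generatorWeight_eq_zero hai, zero_mul, mul_zero, ite_self, add_zero]
  rcases lt_or_ge b j with hbj | hjb
  · simp only [generatorWeight_eq_zero hbj, zero_mul, mul_zero, ite_self, add_zero]
  rw [← zpow_mul_splitCoeff hia hjb, kMul_pairTilde hia hjb, Finsupp.add_apply,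
    Finsupp.single_apply, Finsupp.single_apply]
  simp only [eq_comm (b := C)]
  generalize v ^ ((if i = j then 1 else 0) + if j = a then 1 else 0 : ℤ) = x
  split_ifs <;> ring

open Classical in
/-- The coefficients of the normalized element `∑_ν v ^ (ν i + ν j) [E_{ia} + E_{jb} + diag ν]`,
in which the two factors do not interact. -/
def pairCoeff (i a j b : Fin n) (ν : Fin n → ℤ) (C : ThetaTilde n) : Qv :=
  if C = pairTilde i a j b ν then generatorWeight i a * generatorWeight j b * v ^ (ν i + ν j) else 0

theorem pairCoeff_comm (i a j b : Fin n) (ν : Fin n → ℤ) (C : ThetaTilde n) :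
    pairCoeff i a j b ν C = pairCoeff j b i a ν C := by
  rw [pairCoeff, pairCoeff, pairTilde_comm, mul_comm (generatorWeight i a), add_comm (ν i)]

theorem tbar_mul_tbar_apply (i a j b : Fin n) {C : ThetaTilde n} {ν : Fin n → ℤ}
    (hC : ro C = Pi.single i 1 + Pi.single j 1 + ν) :
    (tbar i a * tbar j b).1 C = splitFactor i a j b * pairCoeff i a j b ν C +
      if i < j ∧ a < b then (v - v⁻¹) * pairCoeff i b j a ν C else 0 := by
  have hweights : (tbar i a * tbar j b).1 C =
      generatorWeight i a * generatorWeight j b *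
        (v ^ ((if i = j then 1 else 0) + if j = a then 1 else 0 : ℤ) *
          kMul (pairTilde i a j j ν) (pairTilde j b a a ν) C) * v ^ (ν i + ν j) := by
    rw [tbar_mul_tbar_apply_eq_kMul i a j b hC, tbar_apply_pairTilde, tbar_apply_pairTilde]
    simp only [zpow_add₀ v_ne_zero]
    ring
  rw [hweights, generatorWeight_mul_kMul_pairTilde]
  simp only [pairCoeff]
  split_ifs <;> ring

theorem exchange_relation (i a j b : Fin n) {x y : Qv} (hxy : i = j ∨ a = b → x = y) :
    v ^ (-delta (i = j)) *
          (splitFactor i a j b * x + if i < j ∧ a < b then (v - v⁻¹) * y else 0) -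
        v ^ (-delta (a = b)) *
          (splitFactor j b i a * x + if j < i ∧ b < a then (v - v⁻¹) * y else 0) =
      (v⁻¹ - v) * ((delta (b < a) - delta (i < j) : ℤ) : Qv) *
        (splitFactor j a i b * y + if j < i ∧ a < b then (v - v⁻¹) * x else 0) := by
  by_cases hsame : i = j ∧ a = b
  · obtain ⟨rfl, rfl⟩ := hsame
    simp only [delta, lt_irrefl, false_and, if_false, sub_self, Int.cast_zero, mul_zero, zero_mul]
  have hv := v_ne_zero
  simp only [splitFactor, delta, Fin.lt_def, Fin.ext_iff] at hxy hsame ⊢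
  rcases lt_trichotomy i.1 j with hij | hij | hij <;>
    rcases lt_trichotomy a.1 b with hab | hab | hab <;>
    first
    | omega
    | simp (disch := omega) only [if_pos, if_neg, hxy]
      norm_num <;> field_simp <;> ring

end Generators

end BLM

end

theorem mainTheorem2 (n : ℕ) :
    (∀ (i j a b : Fin n) (A B : BLM.ThetaTilde n),
      (BLM.tbar i a).1 A ≠ 0 → (BLM.tbar j b).1 B ≠ 0 → BLM.co A = BLM.ro B →
        BLM.StableProductDefined A B) ∧
    ∀ i j a b : Fin n,
      (BLM.v ^ (-BLM.delta (i = j))) • (BLM.tU i a * BLM.tU j b)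
        - (BLM.v ^ (-BLM.delta (a = b))) • (BLM.tU j b * BLM.tU i a)
      = ((BLM.v⁻¹ - BLM.v) * ((BLM.delta (b < a) - BLM.delta (i < j) : ℤ) : BLM.Qv)) •
          (BLM.tU j a * BLM.tU i b) := by
  refine ⟨fun i j a b A B hA hB hAB => ?_, fun i j a b => ?_⟩
  · obtain ⟨hia, hjb, ν, rfl, rfl⟩ := BLM.exists_eq_pairTilde_pair hA hB hAB
    exact BLM.stableProductDefined_pairTilde hia hjb ν
  · refine Subtype.ext (Subtype.ext (funext fun C => ?_))
    change BLM.v ^ (-BLM.delta (i = j)) * (BLM.tbar i a * BLM.tbar j b).1 C -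
        BLM.v ^ (-BLM.delta (a = b)) * (BLM.tbar j b * BLM.tbar i a).1 C =
      ((BLM.v⁻¹ - BLM.v) * ((BLM.delta (b < a) - BLM.delta (i < j) : ℤ) : BLM.Qv)) *
        (BLM.tbar j a * BLM.tbar i b).1 C
    obtain ⟨ν, hij⟩ : ∃ ν, BLM.ro C = Pi.single i 1 + Pi.single j 1 + ν :=
      ⟨_, (add_sub_cancel _ _).symm⟩
    have hji : BLM.ro C = Pi.single j 1 + Pi.single i 1 + ν := by rw [hij, add_comm (Pi.single i 1)]
    rw [BLM.tbar_mul_tbar_apply i a j b hij, BLM.tbar_mul_tbar_apply j b i a hji,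
      BLM.tbar_mul_tbar_apply j a i b hji, BLM.pairCoeff_comm j b i a, BLM.pairCoeff_comm j a i b]
    refine BLM.exchange_relation i a j b ?_
    rintro (rfl | rfl)
    · exact BLM.pairCoeff_comm i a i b ν C
    · rfl
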